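/- **Setting.** Let $S$ be a finite set of prime numbers, $\mathbb{Q}_S=\prod_{p\in S}\mathbb{Q}_p$ with the product topology, $\mathbb{Z}_S=\prod_{p\in S}\mathbb{Z}_p$, and let $dx$ be the Haar measure of $(\mathbb{Q}_S,+)$ with total mass $1$ on $\mathbb{Z}_S$. Let $\chi(x)=\prod_{p\in S}e^{2\pi i\{x_p\}_p}$, where $\{\cdot\}_p$ is the $p$-adic fractional part. For an integer $n\ge 0$ put $e^{\psi(n)}=\operatorname{lcm}\{p^l\le n: p\in S,\ l\ge 0\}$ (so $\psi(0)=0$), and $\psi(-n)=-\psi(n)$. For $x\in\mathbb{Q}_S\setminus\{0\}$ let $\operatorname{ord}(x)=\max\{n\in\mathbb{Z}: x\in e^{\psi(n)}\mathbb{Z}_S\}$ and $\|x\|=e^{-\psi(\operatorname{ord}(x))}$; let $\|0\|=0$. Let $\mathcal{F}f=\widehat f$ be the unitary Fourier transform on $L^2(\mathbb{Q}_S)$ (complex valued functions) that extends $\widehat\phi(\xi)=\int_{\mathbb{Q}_S}\phi(x)\chi(\xi x)\,dx$ from the locally constant functions $\phi$ of compact support. For $\alpha>0$ let $$\operatorname{Dom}(D^\alpha)=\{f\in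 L^2(\mathbb{Q}_S):\|\xi\|^\alpha\widehat f\in L^2(\mathbb{Q}_S)\},\qquad D^\alpha f=\mathcal{F}^{-1}\big[\|\xi\|^\alpha\widehat f\,\big],$$ with the graph norm on $\operatorname{Dom}(D^\alpha)$, and $$Z(x,t)=\int_{\mathbb{Q}_S}\chi(-x\xi)\,e^{-t\|\xi\|^\alpha}\,d\xi\qquad(x\in\mathbb{Q}_S,\ t>0).$$ **Theorem 6.2 (Duhamel's principle).** Let $\alpha>0$, $T>0$, $u_0\in\operatorname{Dom}(D^\alpha)$ and $f\in C([0,T],L^2(\mathbb{Q}_S))$, and assume that at least one of the following holds: 1. $f\in L^1((0,T),\operatorname{Dom}(D^\alpha))$; 2. $f\in W^{1,1}((0,T),L^2(\mathbb{Q}_S))$. Then the Cauchy problem $$u_t+D^\alpha u=f\quad\text{on }[0,T],\qquad u(0)=u_0,$$ has exactly one classical solution, that is, exactly one $u\in C^1([0,T],L^2(\mathbb{Q}_S))$ (with one-sided derivatives at the end points) such that $u(t)\in\operatorname{Dom}(D^\alpha)$ and $u'(t)+D^\alpha u(t)=f(t)$ for all $t\in[0,T]$, and $u(0)=u_0$.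 For every $t\in(0,T]$ and almost every $x\in\mathbb{Q}_S$ it is given by $$u(x,t)=\int_{\mathbb{Q}_S}Z(x-y,t)\,u_0(y)\,dy+\int_0^t\left\{\int_{\mathbb{Q}_S}Z(x-y,t-\tau)\,f(y,\tau)\,dy\right\}d\tau .$$ Here the integrals over $y$ converge absolutely for all $x\in\mathbb{Q}_S$ and $\tau\in[0,t)$, and for every $t\in(0,T]$ the integral over $\tau$ converges absolutely for almost every $x$. -/

import Mathlib

open MeasureTheory Set
open scoped ContDiff

noncomputable section

namespace SAdic

/-! ### The ring `ℚ_S`, its Haar measure and its canonical character -/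

instance factPrime (p : Nat.Primes) : Fact (Nat.Prime (p : ℕ)) := ⟨p.2⟩

instance padicMeasurableSpace (p : ℕ) [Fact p.Prime] : MeasurableSpace ℚ_[p] := borel _

instance padicBorelSpace (p : ℕ) [Fact p.Prime] : BorelSpace ℚ_[p] := ⟨rfl⟩

/-- The ring `ℚ_S = ∏_{p ∈ S} ℚ_p`, for a finite set `S` of primes, with the product topology
and the componentwise operations. -/
abbrev QS (S : Finset Nat.Primes) : Type := ∀ p : S, ℚ_[((p : Nat.Primes) : ℕ)]

variable (S : Finset Nat.Primes)

/-- The subring `ℤ_S = ∏_{p ∈ S} ℤ_p`, as a subset of `ℚ_S`. -/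
def ZS : Set (QS S) := {x | ∀ p, ‖x p‖ ≤ 1}

theorem ZS_eq_pi : ZS S = Set.pi univ fun _ => Metric.closedBall 0 1 := by
  ext x; simp [ZS]

theorem isCompact_ZS : IsCompact (ZS S) := by
  rw [ZS_eq_pi]
  exact isCompact_univ_pi fun _ => isCompact_closedBall _ _

theorem interior_ZS_nonempty : (interior (ZS S)).Nonempty := by
  refine ⟨0, mem_interior.2 ⟨Set.pi univ fun _ => Metric.ball 0 1, ?_, ?_, ?_⟩⟩
  · rw [ZS_eq_pi]
    exact Set.pi_mono fun _ _ => Metric.ball_subset_closedBall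
  · exact isOpen_set_pi finite_univ fun _ _ => Metric.isOpen_ball
  · simp

/-- The Haar measure of `(ℚ_S, +)`, normalised by `μ(ℤ_S) = 1`. -/
def haarQS : Measure (QS S) :=
  Measure.addHaarMeasure ⟨⟨ZS S, isCompact_ZS S⟩, interior_ZS_nonempty S⟩

/-- The Hilbert space `L²(ℚ_S)` of complex valued square integrable functions. -/
abbrev L2 : Type := Lp ℂ 2 (haarQS S)

theorem norm_pow_mul_le_one (p : ℕ) [Fact p.Prime] (x : ℚ_[p]) :
    ‖(p : ℚ_[p]) ^ (-x.valuation).toNat * x‖ ≤ 1 := by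
  by_cases hx : x = 0
  · simp [hx]
  · have hp : (1 : ℝ) < p := by exact_mod_cast (Fact.out : p.Prime).one_lt
    rw [norm_mul, norm_pow, Padic.norm_p, Padic.norm_eq_zpow_neg_valuation hx, inv_pow,
      ← zpow_natCast, ← zpow_neg, ← zpow_add₀ (by positivity)]
    apply zpow_le_one_of_nonpos₀ hp.le
    have := Int.self_le_toNat (-x.valuation)
    omega

/-- The fractional part `{x}_p` of a `p`-adic number `x = p^γ ∑ aᵢ pⁱ`: with `n = max (-γ) 0`,
the `p`-adic integer `p^n x` is truncated to its first `n` digits and divided by `p^n`. -/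
def padicFract (p : ℕ) [Fact p.Prime] (x : ℚ_[p]) : ℝ :=
  (PadicInt.appr ⟨_, norm_pow_mul_le_one p x⟩ (-x.valuation).toNat : ℝ)
    / (p : ℝ) ^ (-x.valuation).toNat

/-- The canonical additive character `χ(x) = ∏_{p ∈ S} exp(2πi {x_p}_p)` of `ℚ_S`. -/
def chi (x : QS S) : ℂ := ∏ p : S, Complex.exp (2 * Real.pi * Complex.I * padicFract _ (x p))

/-! ### The filtration and the norm attached to the ultrametric -/

/-- `e^{ψ(n)} = lcm {p^l ≤ n : p ∈ S, l ≥ 0}` for a natural number `n`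
(equal to `1` for `n = 0`). -/
def expPsiNat (n : ℕ) : ℕ :=
  open Classical in
  ((Finset.Icc 1 n).filter fun m => ∃ p ∈ S, ∃ l : ℕ, m = (p : ℕ) ^ l).lcm id

/-- `e^{ψ(n)}` for an integer `n`, where `ψ(n) = sgn(n) ψ(|n|)`. -/
def expPsi (n : ℤ) : ℚ := (expPsiNat S n.natAbs : ℚ) ^ n.sign

/-- The compact open subgroup `e^{ψ(n)} ℤ_S`. -/
def filtration (n : ℤ) : Set (QS S) :=
  {x | ∃ z ∈ ZS S, ∀ p, x p = (expPsi S n : ℚ_[((p : Nat.Primes) : ℕ)]) * z p}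

/-- The order `max {n : x ∈ e^{ψ(n)} ℤ_S}` of a nonzero element (it is not used at `x = 0`). -/
def order (x : QS S) : ℤ := sSup {n | x ∈ filtration S n}

/-- The norm `‖x‖ = e^{-ψ(ord x)}`, `‖0‖ = 0`, induced by the ultrametric on `ℚ_S`. -/
def normS (x : QS S) : ℝ :=
  open Classical in
  if x = 0 then 0 else ((expPsi S (order S x) : ℚ) : ℝ)⁻¹

/-! ### The Fourier transform and the operator `D^α` -/

/-- The Fourier integral `φ̂(ξ) = ∫ φ(x) χ(ξ x) dx`. -/
def fourierInt (φ : QS S → ℂ) (ξ : QS S) : ℂ := ∫ x, φ x * chi S (ξ * x) ∂haarQS S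

/-- The graph of the Fourier transform on `L²(ℚ_S)`: the closure in `L² × L²` of the set of the
pairs `(φ, φ̂)` where `φ` is a Bruhat-Schwartz function (locally constant, compactly supported). -/
def fourierGraph : Submodule ℂ (L2 S × L2 S) :=
  (Submodule.span ℂ {q : L2 S × L2 S | ∃ φ : QS S → ℂ, IsLocallyConstant φ ∧
    HasCompactSupport φ ∧ q.1 =ᵐ[haarQS S] φ ∧
    q.2 =ᵐ[haarQS S] fourierInt S φ}).topologicalClosure

/-- `IsFourier S f F` means that `F` is the Fourier transform of `f ∈ L²(ℚ_S)`. -/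
def IsFourier (f F : L2 S) : Prop := (f, F) ∈ fourierGraph S

/-- `Dom(D^α) = {f ∈ L² : ‖ξ‖^α f̂ ∈ L²}`. -/
def domD (α : ℝ) : Set (L2 S) :=
  {f | ∃ F : L2 S, IsFourier S f F ∧
    MemLp (fun ξ => ((normS S ξ ^ α : ℝ) : ℂ) * F ξ) 2 (haarQS S)}

/-- The graph of `D^α = 𝓕⁻¹ ∘ (‖ξ‖^α ·) ∘ 𝓕`, that is, the pairs `(f, h)` in `L² × L²` with
`ĥ(ξ) = ‖ξ‖^α f̂(ξ)`.  With the norm inherited from `L² × L²`, it is `Dom(D^α)` with its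
graph norm. -/
def graphD (α : ℝ) : Submodule ℂ (L2 S × L2 S) where
  carrier := {q | ∃ F H : L2 S, IsFourier S q.1 F ∧ IsFourier S q.2 H ∧
    H =ᵐ[haarQS S] fun ξ => ((normS S ξ ^ α : ℝ) : ℂ) * F ξ}
  zero_mem' := by
    refine ⟨0, 0, (fourierGraph S).zero_mem, (fourierGraph S).zero_mem, ?_⟩
    filter_upwards [Lp.coeFn_zero ℂ 2 (haarQS S)] with ξ h
    rw [h, Pi.zero_apply, mul_zero]
  add_mem' := by
    rintro a b ⟨F, H, h1, h2, h3⟩ ⟨F', H', h1', h2', h3'⟩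
    refine ⟨F + F', H + H', (fourierGraph S).add_mem h1 h1', (fourierGraph S).add_mem h2 h2', ?_⟩
    filter_upwards [h3, h3', Lp.coeFn_add F F', Lp.coeFn_add H H'] with ξ e1 e2 e3 e4
    simp only [e3, e4, Pi.add_apply, e1, e2, mul_add]
  smul_mem' := by
    rintro c a ⟨F, H, h1, h2, h3⟩
    refine ⟨c • F, c • H, (fourierGraph S).smul_mem c h1, (fourierGraph S).smul_mem c h2, ?_⟩
    filter_upwards [h3, Lp.coeFn_smul c F, Lp.coeFn_smul c H] with ξ e1 e3 e4
    simp only [e3, e4, Pi.smul_apply, e1, smul_eq_mul]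
    ring

/-! ### The Cauchy problem -/

/-- The heat kernel `Z(x,t) = ∫ χ(-xξ) exp(-t ‖ξ‖^α) dξ`. -/
def heatKernel (α : ℝ) (x : QS S) (t : ℝ) : ℂ :=
  ∫ ξ, chi S (-(x * ξ)) * (Real.exp (-t * normS S ξ ^ α) : ℂ) ∂haarQS S

/-- A classical solution on `[0,T]` of `u_t + D^α u = f`, `u(0) = u₀`: a continuously
differentiable map `u : [0,T] → L²` (with one-sided derivatives at the end points) such that
`u(t) ∈ Dom(D^α)` and `D^α u(t) = f(t) - u'(t)` for all `t ∈ [0,T]`, and `u(0) = u₀`. -/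
def IsClassicalSolution (α T : ℝ) (f : ℝ → L2 S) (u₀ : L2 S) (u : ℝ → L2 S) : Prop :=
  u 0 = u₀ ∧ ∃ u' : ℝ → L2 S, ContinuousOn u' (Icc 0 T) ∧
    ∀ t ∈ Icc 0 T, HasDerivWithinAt u (u' t) (Icc 0 T) t ∧ u t ∈ domD S α ∧
      (u t, f t - u' t) ∈ graphD S α

/-- `f ∈ L¹((0,T), Dom(D^α))`, where `Dom(D^α)` carries its graph norm: almost every `f(t)` is
the first component of `g(t)`, for a Bochner integrable `g` with values in the graph of `D^α`. -/
def MemL1Dom (α T : ℝ) (f : ℝ → L2 S) : Prop :=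
  ∃ g : ℝ → graphD S α, IntegrableOn g (Ioo 0 T) ∧
    ∀ᵐ t ∂(volume.restrict (Ioo 0 T)), (g t : L2 S × L2 S).1 = f t

/-- `f ∈ W^{1,1}((0,T), X)`: `f` and its weak derivative are Bochner integrable on `(0,T)`. -/
def MemW11 {X : Type*} [NormedAddCommGroup X] [NormedSpace ℝ X] (T : ℝ) (f : ℝ → X) : Prop :=
  IntegrableOn f (Ioo 0 T) ∧ ∃ g : ℝ → X, IntegrableOn g (Ioo 0 T) ∧
    ∀ φ : ℝ → ℝ, ContDiff ℝ ∞ φ → HasCompactSupport φ → tsupport φ ⊆ Ioo 0 T →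
      ∫ t in Ioo 0 T, deriv φ t • f t = -∫ t in Ioo 0 T, φ t • g t

end SAdic

end

/-! The Fourier transform is unitary and turns `D^α` into multiplication by `w = ‖ξ‖^α ≥ 0`, so the
Cauchy problem becomes a scalar linear equation at each frequency, solved by `e^{-tw}`. The proof
has an arithmetic half and an abstract half.

Arithmetic: the annihilator of `e^{ψ(n)}ℤ_S` under `χ` is `e^{ψ(-n)}ℤ_S`, and the volumes of these
two groups are inverse to each other. This gives inversion and Parseval for Bruhat-Schwartz
functions, so the closure of their Fourier graph is the graph of a unitary operator
(`isFourier_iff`). A ball of radius `N` has volume at most `N^|S|`, hence `e^{-tw}` lies in `L¹ ∩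
L²` (`integrable_exp_neg_normS`) and the semigroup is convolution with `Z` (`heatFamily_E_ae_eq`).

Abstract: a nonnegative operator `A` is encoded by its bounded resolvent `R = (1+A)⁻¹`; `y = A x`
means `R (x + y) = x`. The semigroup law is not needed. Existence rests on strong continuity,
contractivity, commutation with `R` and the identity `A ∫₀ᵗ E_s x ds = x - E_t x`. When `f` is
integrable into the domain, or is a primitive, Fubini on a triangle writes the mild term as the
integral of a continuous function `w`, and moving `R` under the integral shows `w = f - A(mild
term)` (`exists_deriv_mild_solution`). Uniqueness is the energy estimate: the squared norm of the
difference of two solutions decreases.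

The pointwise formula follows because the convolution at `x` is the `L²` pairing of `û` with a
symbol depending continuously on `(x, t)`; this supplies the joint measurability needed to evaluate
a Bochner integral in `L²` almost everywhere (`integral_L2_ae_eq`). -/

namespace SAdic

/-! ### The canonical character -/

section PadicCharacter

variable {p : ℕ} [Fact p.Prime]

/-- The `p`-adic fractional part is a rational number of `[0,1)`, with a power of `p` as a
denominator, that differs from the given number by a `p`-adic integer. -/
theorem padicFract_spec (x : ℚ_[p]) : ∃ r : ℚ, padicFract p x = r ∧ 0 ≤ r ∧ r < 1 ∧
    (∃ k : ℕ, ∃ n : ℤ, r * (p : ℚ) ^ k = n) ∧ ‖x - r‖ ≤ 1 := by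
  have hp0 : (p : ℚ_[p]) ≠ 0 := by exact_mod_cast (Fact.out : p.Prime).ne_zero
  have hp : (0 : ℚ) < p := by exact_mod_cast (Fact.out : p.Prime).pos
  set k := (-x.valuation).toNat with hk
  set X : ℤ_[p] := ⟨_, norm_pow_mul_le_one p x⟩ with hX
  refine ⟨(X.appr k : ℚ) / (p : ℚ) ^ k, ?_, by positivity, ?_, ⟨k, X.appr k, ?_⟩, ?_⟩
  · simp [padicFract, hX, hk]
  · rw [div_lt_one (by positivity)]
    exact_mod_cast PadicInt.appr_lt X k
  · rw [div_mul_cancel₀ _ (by positivity)]; simp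
  · have h := (PadicInt.norm_le_pow_iff_mem_span_pow _ k).2 (PadicInt.appr_spec k X)
    rw [PadicInt.norm_def] at h
    push_cast at h
    have e : x - (((X.appr k : ℚ) / (p : ℚ) ^ k : ℚ) : ℚ_[p])
        = ((X : ℚ_[p]) - (X.appr k : ℚ_[p])) / (p : ℚ_[p]) ^ k := by
      have hXk : (X : ℚ_[p]) = (p : ℚ_[p]) ^ k * x := rfl
      rw [hXk]; push_cast; field_simp
    have hp' : (0 : ℝ) < p := by exact_mod_cast hp
    rw [e, norm_div, norm_pow, Padic.norm_p, div_le_one (by positivity)]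
    simpa using h

/-- The only prime in the denominator is `p`, and `p`-adic integrality removes it: `p ^ k` divides
the numerator. -/
theorem exists_int_of_padic_norm_le_one {r : ℚ} (hr : ∃ k : ℕ, ∃ n : ℤ, r * (p : ℚ) ^ k = n)
    (h : ‖(r : ℚ_[p])‖ ≤ 1) : ∃ n : ℤ, r = n := by
  obtain ⟨k, n, hn⟩ := hr
  have hp : (p : ℚ) ≠ 0 := by exact_mod_cast (Fact.out : p.Prime).ne_zero
  have hd : ((p : ℤ) ^ k) ∣ n := by
    rw [← Nat.cast_pow, Nat.cast_pow, ← Padic.norm_int_le_pow_iff_dvd]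
    have : ((n : ℤ) : ℚ_[p]) = r * (p : ℚ_[p]) ^ k := by exact_mod_cast congrArg (Rat.cast (K := ℚ_[p])) hn.symm
    rw [this, norm_mul, norm_pow, Padic.norm_p, inv_pow, zpow_neg, zpow_natCast]
    exact mul_le_of_le_one_left (by positivity) h
  obtain ⟨m, rfl⟩ := hd
  refine ⟨m, mul_right_cancel₀ (pow_ne_zero k hp) ?_⟩
  rw [hn]; push_cast; ring

/-- The canonical character `x ↦ exp(2πi {x}_p)` of `ℚ_p`. -/
noncomputable def padicChar (p : ℕ) [Fact p.Prime] (x : ℚ_[p]) : ℂ :=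
  Complex.exp (2 * Real.pi * Complex.I * padicFract p x)

/-- Fractional parts are additive only up to an integer: `r + s - t` has a `p`-power denominator and
is a `p`-adic integer, hence lies in `ℤ`, which the exponential does not see. -/
theorem padicChar_add (x y : ℚ_[p]) : padicChar p (x + y) = padicChar p x * padicChar p y := by
  obtain ⟨r, hr, -, -, ⟨k, n, hn⟩, hx⟩ := padicFract_spec x
  obtain ⟨s, hs, -, -, ⟨l, m, hm⟩, hy⟩ := padicFract_spec y
  obtain ⟨t, ht, -, -, ⟨j, i, hi⟩, hz⟩ := padicFract_spec (x + y)
  have h1 : ‖((r + s - t : ℚ) : ℚ_[p])‖ ≤ 1 := by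
    have : ((r + s - t : ℚ) : ℚ_[p]) = (x + y - t) + (-(x - r) + -(y - s)) := by push_cast; ring
    rw [this]
    refine (IsUltrametricDist.norm_add_le_max _ _).trans (max_le hz ?_)
    refine (IsUltrametricDist.norm_add_le_max _ _).trans ?_
    rw [norm_neg, norm_neg]
    exact max_le hx hy
  obtain ⟨q, hq⟩ := exists_int_of_padic_norm_le_one (p := p) (r := r + s - t)
    ⟨k + l + j, n * p ^ (l + j) + m * p ^ (k + j) - i * p ^ (k + l), by
      push_cast; rw [← hn, ← hm, ← hi]; ring⟩ h1
  have e : ((t : ℝ) : ℂ) = (r : ℝ) + (s : ℝ) - (q : ℂ) := by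
    have : t = r + s - q := by rw [← hq]; ring
    rw [this]; push_cast; ring
  rw [padicChar, padicChar, padicChar, hr, hs, ht, ← Complex.exp_add, e,
    Complex.exp_eq_exp_iff_exists_int]
  exact ⟨-q, by push_cast; ring⟩

theorem padicChar_eq_one_of_norm_le_one {x : ℚ_[p]} (hx : ‖x‖ ≤ 1) : padicChar p x = 1 := by
  obtain ⟨r, hr, h0, h1, hk, hx'⟩ := padicFract_spec x
  have : ‖(r : ℚ_[p])‖ ≤ 1 := by
    have e : (r : ℚ_[p]) = x + -(x - r) := by ring
    rw [e]
    refine (IsUltrametricDist.norm_add_le_max _ _).trans (max_le hx ?_)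
    rwa [norm_neg]
  obtain ⟨n, rfl⟩ := exists_int_of_padic_norm_le_one hk this
  have : n = 0 := by
    have : 0 ≤ n := by exact_mod_cast h0
    have : n < 1 := by exact_mod_cast h1
    omega
  simp [padicChar, hr, this]

theorem norm_padicChar (x : ℚ_[p]) : ‖padicChar p x‖ = 1 := by
  rw [padicChar, show (2 * Real.pi * Complex.I * padicFract p x : ℂ)
    = ((2 * Real.pi * padicFract p x : ℝ) : ℂ) * Complex.I by push_cast; ring]
  exact Complex.norm_exp_ofReal_mul_I _

/-- Nontriviality just outside `ℤ_p`. A trivial value would force the fractional part to be an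
integer in `[0,1)`, so `0`, making `1/p` a `p`-adic integer. -/
theorem padicChar_inv_prime_ne_one : padicChar p ((p : ℚ_[p])⁻¹) ≠ 1 := by
  obtain ⟨r, hr, h0, h1, -, hx⟩ := padicFract_spec ((p : ℚ_[p])⁻¹)
  have hp : (1 : ℝ) < p := by exact_mod_cast (Fact.out : p.Prime).one_lt
  intro h
  rw [padicChar, hr, Complex.exp_eq_one_iff] at h
  obtain ⟨n, hn⟩ := h
  have hrn : r = n := by
    have : ((r : ℝ) : ℂ) = n := by
      have h2 : (2 * Real.pi * Complex.I : ℂ) ≠ 0 := Complex.two_pi_I_ne_zero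
      apply mul_left_cancel₀ h2
      rw [hn]; ring
    exact_mod_cast this
  have : n = 0 := by
    subst hrn
    have : 0 ≤ n := by exact_mod_cast h0
    have : n < 1 := by exact_mod_cast h1
    omega
  rw [hrn, this] at hx
  have hx' : ((p : ℝ)) ≤ 1 := by simpa using hx
  linarith

end PadicCharacter

variable {S : Finset Nat.Primes}

theorem chi_eq_prod (x : QS S) : chi S x = ∏ p : S, padicChar _ (x p) := rfl

theorem chi_add (x y : QS S) : chi S (x + y) = chi S x * chi S y := by
  simp only [chi_eq_prod, Pi.add_apply, padicChar_add, Finset.prod_mul_distrib]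

theorem chi_eq_one {x : QS S} (hx : x ∈ ZS S) : chi S x = 1 := by
  rw [chi_eq_prod]
  exact Finset.prod_eq_one fun p _ => padicChar_eq_one_of_norm_le_one (hx p)

theorem norm_chi (x : QS S) : ‖chi S x‖ = 1 := by
  rw [chi_eq_prod, norm_prod]
  exact Finset.prod_eq_one fun p _ => norm_padicChar _

@[simp] theorem chi_zero : chi S (0 : QS S) = 1 := chi_eq_one fun p => by simp

theorem conj_chi (x : QS S) : starRingEnd ℂ (chi S x) = chi S (-x) := by
  have h : chi S x * chi S (-x) = 1 := by rw [← chi_add, add_neg_cancel, chi_zero]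
  have h2 : chi S x * starRingEnd ℂ (chi S x) = 1 := by
    rw [Complex.mul_conj, Complex.normSq_eq_norm_sq, norm_chi]; simp
  have h0 : chi S x ≠ 0 := by rw [← norm_ne_zero_iff, norm_chi]; exact one_ne_zero
  exact mul_left_cancel₀ h0 (h2.trans h.symm)

theorem isOpen_ZS : IsOpen (ZS S) := by
  rw [ZS_eq_pi]
  exact isOpen_set_pi finite_univ fun _ _ => IsUltrametricDist.isOpen_closedBall _ one_ne_zero

theorem zero_mem_ZS : (0 : QS S) ∈ ZS S := fun p => by simp

theorem isLocallyConstant_chi : IsLocallyConstant (chi S) := by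
  refine (IsLocallyConstant.iff_eventually_eq _).2 fun x => ?_
  have h : Filter.Tendsto (fun y => y - x) (nhds x) (nhds 0) := by
    have : Continuous fun y : QS S => y - x := by fun_prop
    simpa using this.tendsto x
  filter_upwards [h (isOpen_ZS.mem_nhds zero_mem_ZS)] with y hy
  rw [show y = y - x + x by ring, chi_add, chi_eq_one hy, one_mul]

theorem continuous_chi : Continuous (chi S) := isLocallyConstant_chi.continuous

/-- The character `χ` detects the ring `ℤ_S`. -/
theorem exists_chi_ne_one {ξ : QS S} (hξ : ξ ∉ ZS S) : ∃ z ∈ ZS S, chi S (ξ * z) ≠ 1 := by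
  simp only [ZS, mem_ofPred_eq, not_forall, not_le] at hξ
  obtain ⟨p, hp⟩ := hξ
  have h0 : ξ p ≠ 0 := fun h => by rw [h, norm_zero] at hp; linarith
  have hpp : (1 : ℝ) < ((p : Nat.Primes) : ℕ) := by
    exact_mod_cast (Fact.out : ((p : Nat.Primes) : ℕ).Prime).one_lt
  -- The witness is supported at one prime and makes the product `ξ z` equal to `1/p` there.
  refine ⟨Pi.single p ((ξ p)⁻¹ * ((((p : Nat.Primes) : ℕ) : ℚ_[((p : Nat.Primes) : ℕ)]))⁻¹), ?_, ?_⟩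
  · intro q
    by_cases hq : q = p
    · subst hq
      rw [Pi.single_eq_same, norm_mul, norm_inv, norm_inv, Padic.norm_p, inv_inv]
      set x := ξ q
      rw [inv_mul_le_iff₀ (by linarith), mul_one]
      -- Norms are powers of `p`, so `‖x‖ > 1` already gives `‖x‖ ≥ p`.
      have hm := Padic.norm_le_pow_iff_norm_lt_pow_add_one x 0
      by_contra hlt
      rw [not_le] at hlt
      have := hm.2 (by simpa using hlt)
      simp only [zpow_zero] at this
      linarith
    · rw [Pi.single_eq_of_ne hq]; simp
  · rw [chi_eq_prod, Finset.prod_eq_single p]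
    · rw [Pi.mul_apply, Pi.single_eq_same, ← mul_assoc, mul_inv_cancel₀ h0, one_mul]
      exact padicChar_inv_prime_ne_one
    · intro q _ hq
      apply padicChar_eq_one_of_norm_le_one
      rw [Pi.mul_apply, Pi.single_eq_of_ne hq]; simp
    · simp

/-! ### The filtration by compact open subgroups -/

theorem expPsiNat_pos (n : ℕ) : 0 < expPsiNat S n := by
  classical
  rw [Nat.pos_iff_ne_zero, expPsiNat, ne_eq, Finset.lcm_eq_zero_iff]
  simp only [id]
  intro ⟨m, hm, h0⟩
  simp at hm
  omega

theorem expPsiNat_zero : expPsiNat S 0 = 1 := by simp [expPsiNat]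

theorem expPsiNat_dvd {m n : ℕ} (h : m ≤ n) : expPsiNat S m ∣ expPsiNat S n := by
  classical
  refine Finset.lcm_dvd fun b hb => Finset.dvd_lcm (f := id) ?_
  simp only [Finset.mem_filter, Finset.mem_Icc] at hb ⊢
  exact ⟨⟨hb.1.1, hb.1.2.trans h⟩, hb.2⟩

theorem pow_dvd_expPsiNat {p : Nat.Primes} (hp : p ∈ S) {l n : ℕ} (h : (p : ℕ) ^ l ≤ n) :
    (p : ℕ) ^ l ∣ expPsiNat S n := by
  classical
  refine Finset.dvd_lcm (f := id) ?_
  simp only [Finset.mem_filter, Finset.mem_Icc]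
  exact ⟨⟨Nat.one_le_pow _ _ p.2.pos, h⟩, p, hp, l, rfl⟩

theorem expPsi_natCast (n : ℕ) : expPsi S n = expPsiNat S n := by
  rcases n.eq_zero_or_pos with rfl | h
  · simp [expPsi, expPsiNat_zero]
  · simp [expPsi, Int.sign_natCast_of_ne_zero h.ne']

theorem expPsi_neg (n : ℤ) : expPsi S (-n) = (expPsi S n)⁻¹ := by
  simp [expPsi]

theorem expPsi_zero : expPsi S 0 = 1 := by simp [expPsi]

theorem expPsi_pos (n : ℤ) : 0 < expPsi S n := by
  have := expPsiNat_pos (S := S) n.natAbs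
  rw [expPsi]; positivity

theorem exists_expPsi_eq_mul {m n : ℤ} (h : m ≤ n) : ∃ k : ℕ, expPsi S n = k * expPsi S m := by
  have key : ∀ a b : ℕ, a ≤ b → ∃ k : ℕ, (expPsiNat S b : ℚ) = k * expPsiNat S a := by
    intro a b hab
    obtain ⟨k, hk⟩ := expPsiNat_dvd (S := S) hab
    exact ⟨k, by rw [hk]; push_cast; ring⟩
  have hpos : ∀ a, (expPsiNat S a : ℚ) ≠ 0 := fun a => by exact_mod_cast (expPsiNat_pos a).ne'
  obtain ⟨a, rfl | rfl⟩ := n.eq_nat_or_neg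
  · obtain ⟨b, rfl | rfl⟩ := m.eq_nat_or_neg
    · rw [expPsi_natCast, expPsi_natCast]
      exact key _ _ (by exact_mod_cast h)
    · refine ⟨expPsiNat S a * expPsiNat S b, ?_⟩
      rw [expPsi_neg, expPsi_natCast, expPsi_natCast]
      have := hpos b
      push_cast; field_simp
  · obtain ⟨b, rfl | rfl⟩ := m.eq_nat_or_neg
    · obtain rfl : a = 0 := by omega
      obtain rfl : b = 0 := by omega
      exact ⟨1, by simp⟩
    · obtain ⟨k, hk⟩ := key a b (by omega)
      refine ⟨k, ?_⟩
      have := hpos a; have := hpos b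
      rw [expPsi_neg, expPsi_natCast, expPsi_neg, expPsi_natCast]
      field_simp
      linarith

theorem expPsi_padic_ne_zero (n : ℤ) (p : S) :
    (expPsi S n : ℚ_[((p : Nat.Primes) : ℕ)]) ≠ 0 := by
  exact_mod_cast (expPsi_pos n).ne'

theorem mem_filtration {n : ℤ} {x : QS S} :
    x ∈ filtration S n ↔ ∀ p : S, ‖x p‖ ≤ ‖(expPsi S n : ℚ_[((p : Nat.Primes) : ℕ)])‖ := by
  constructor
  · rintro ⟨z, hz, h⟩ p
    rw [h p, norm_mul]
    exact mul_le_of_le_one_right (norm_nonneg _) (hz p)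
  · intro h
    refine ⟨fun p => (expPsi S n : ℚ_[((p : Nat.Primes) : ℕ)])⁻¹ * x p, fun p => ?_, fun p => ?_⟩
    · have h0 := norm_pos_iff.2 (expPsi_padic_ne_zero n p)
      rw [norm_mul, norm_inv, inv_mul_le_iff₀ h0, mul_one]
      exact h p
    · rw [mul_inv_cancel_left₀ (expPsi_padic_ne_zero n p)]

theorem filtration_zero : filtration S 0 = ZS S := by
  ext x
  rw [mem_filtration]
  simp [ZS, expPsi_zero]

theorem filtration_anti {m n : ℤ} (h : m ≤ n) : filtration S n ⊆ filtration S m := by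
  obtain ⟨k, hk⟩ := exists_expPsi_eq_mul (S := S) h
  intro x hx
  rw [mem_filtration] at hx ⊢
  intro p
  refine (hx p).trans ?_
  rw [hk]
  push_cast
  rw [norm_mul]
  exact mul_le_of_le_one_left (norm_nonneg _) (by exact_mod_cast Padic.norm_int_le_one (k : ℤ))

theorem zero_mem_filtration (n : ℤ) : (0 : QS S) ∈ filtration S n :=
  mem_filtration.2 fun p => by rw [Pi.zero_apply, norm_zero]; exact norm_nonneg _

theorem add_mem_filtration {n : ℤ} {x y : QS S} (hx : x ∈ filtration S n)
    (hy : y ∈ filtration S n) : x + y ∈ filtration S n := by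
  rw [mem_filtration] at *
  exact fun p => (IsUltrametricDist.norm_add_le_max _ _).trans (max_le (hx p) (hy p))

theorem neg_mem_filtration {n : ℤ} {x : QS S} (hx : x ∈ filtration S n) :
    -x ∈ filtration S n := by
  rw [mem_filtration] at *
  exact fun p => by rw [Pi.neg_apply, norm_neg]; exact hx p

theorem filtration_eq_pi (n : ℤ) : filtration S n = Set.pi univ fun p : S =>
    Metric.closedBall 0 ‖(expPsi S n : ℚ_[((p : Nat.Primes) : ℕ)])‖ := by
  ext x; simp [mem_filtration]

theorem isCompact_filtration (n : ℤ) : IsCompact (filtration S n) := by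
  rw [filtration_eq_pi]
  exact isCompact_univ_pi fun _ => isCompact_closedBall _ _

theorem isOpen_filtration (n : ℤ) : IsOpen (filtration S n) := by
  rw [filtration_eq_pi]
  exact isOpen_set_pi finite_univ fun p _ => IsUltrametricDist.isOpen_closedBall _
    (norm_ne_zero_iff.2 (expPsi_padic_ne_zero n p))

theorem measurableSet_filtration (n : ℤ) : MeasurableSet (filtration S n) :=
  (isOpen_filtration n).measurableSet

theorem exists_norm_expPsi_le {ε : ℝ} (hε : 0 < ε) :
    ∃ n : ℕ, ∀ p : S, ‖(expPsi S n : ℚ_[((p : Nat.Primes) : ℕ)])‖ ≤ ε := by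
  obtain ⟨l, hl⟩ := exists_pow_lt_of_lt_one hε (by norm_num : (1 / 2 : ℝ) < 1)
  -- This sum dominates every `p ^ l`, so all of them divide `e^{ψ(n)}`; then the norm at `p` is at
  -- most `p^{-l} ≤ 2^{-l}`.
  refine ⟨∑ p : S, ((p : Nat.Primes) : ℕ) ^ l, fun p => ?_⟩
  have h1 : ((p : Nat.Primes) : ℕ) ^ l ≤ ∑ p : S, ((p : Nat.Primes) : ℕ) ^ l :=
    Finset.single_le_sum (f := fun p : S => ((p : Nat.Primes) : ℕ) ^ l)
      (fun _ _ => Nat.zero_le _) (Finset.mem_univ p)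
  have h2 := pow_dvd_expPsiNat p.2 h1
  have hp : (2 : ℝ) ≤ ((p : Nat.Primes) : ℕ) := by exact_mod_cast (p : Nat.Primes).2.two_le
  rw [expPsi_natCast]
  have h3 : ‖(((expPsiNat S (∑ p : S, ((p : Nat.Primes) : ℕ) ^ l) : ℕ) : ℤ) :
      ℚ_[((p : Nat.Primes) : ℕ)])‖ ≤ (((p : Nat.Primes) : ℕ) : ℝ) ^ (-(l : ℤ)) := by
    rw [Padic.norm_int_le_pow_iff_dvd]
    exact_mod_cast h2
  push_cast at h3 ⊢
  refine h3.trans (le_trans ?_ hl.le)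
  rw [zpow_neg, zpow_natCast, one_div, inv_pow]
  exact inv_anti₀ (by positivity) (pow_le_pow_left₀ (by norm_num) hp l)

theorem exists_filtration_subset {U : Set (QS S)} (hU : U ∈ nhds (0 : QS S)) :
    ∃ n : ℕ, filtration S n ⊆ U := by
  obtain ⟨ε, hε, h⟩ := Metric.mem_nhds_iff.1 hU
  obtain ⟨n, hn⟩ := exists_norm_expPsi_le (S := S) (half_pos hε)
  refine ⟨n, fun x hx => h ?_⟩
  rw [Metric.mem_ball, dist_pi_lt_iff hε]
  intro p
  rw [Pi.zero_apply, dist_zero_right]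
  have := (mem_filtration.1 hx p).trans (hn p)
  linarith

theorem exists_subset_filtration {K : Set (QS S)} (hK : IsCompact K) :
    ∃ n : ℕ, K ⊆ filtration S (-n) := by
  obtain ⟨R, hR⟩ := hK.isBounded.exists_norm_le
  obtain ⟨n, hn⟩ := exists_norm_expPsi_le (S := S) (inv_pos.2 (lt_max_of_lt_right (b := R) one_pos))
  refine ⟨n, fun x hx => mem_filtration.2 fun p => ?_⟩
  have h0 := norm_pos_iff.2 (expPsi_padic_ne_zero (n : ℤ) p)
  rw [expPsi_neg]
  push_cast
  rw [norm_inv]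
  exact ((norm_le_pi_norm x p).trans ((hR x hx).trans (le_max_left R 1))).trans
    ((le_inv_comm₀ h0 (lt_max_of_lt_right one_pos)).1 (hn p))

theorem exists_mem_filtration (x : QS S) : ∃ n : ℕ, x ∈ filtration S (-n) := by
  obtain ⟨n, hn⟩ := exists_subset_filtration (isCompact_singleton (x := x))
  exact ⟨n, hn rfl⟩

/-- The element `e^{ψ(n)}` of `ℚ_S`, as a unit. -/
noncomputable def expPsiUnit (S : Finset Nat.Primes) (n : ℤ) : (QS S)ˣ where
  val := fun p => (expPsi S n : ℚ_[((p : Nat.Primes) : ℕ)])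
  inv := fun p => (expPsi S n : ℚ_[((p : Nat.Primes) : ℕ)])⁻¹
  val_inv := by ext p; simp [mul_inv_cancel₀ (expPsi_padic_ne_zero n p)]
  inv_val := by ext p; simp [inv_mul_cancel₀ (expPsi_padic_ne_zero n p)]

/-- `ψ` is not additive, so multiplicativity has to be assumed; the cases used are `m = 0` and `m =
-n`, where it is clear. -/
theorem expPsiUnit_mul_mem_iff {m n : ℤ} {x : QS S} (h : expPsi S (m + n) = expPsi S m * expPsi S n) :
    (expPsiUnit S n : QS S) * x ∈ filtration S (m + n) ↔ x ∈ filtration S m := by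
  rw [mem_filtration, mem_filtration]
  refine forall_congr' fun p => ?_
  have h0 := norm_pos_iff.2 (expPsi_padic_ne_zero n p)
  rw [h]
  push_cast
  rw [Pi.mul_apply, norm_mul, norm_mul, mul_comm ‖(expPsi S m : ℚ_[((p : Nat.Primes) : ℕ)])‖]
  exact mul_le_mul_iff_right₀ h0

/-! ### Duality -/

theorem chi_mul_eq_one {n : ℤ} {ξ x : QS S} (hξ : ξ ∈ filtration S (-n))
    (hx : x ∈ filtration S n) : chi S (ξ * x) = 1 := by
  apply chi_eq_one
  intro p
  have h1 := mem_filtration.1 hξ p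
  have h2 := mem_filtration.1 hx p
  have h0 := norm_pos_iff.2 (expPsi_padic_ne_zero n p)
  rw [expPsi_neg] at h1
  push_cast at h1
  rw [norm_inv] at h1
  rw [Pi.mul_apply, norm_mul]
  calc _ ≤ _ := mul_le_mul h1 h2 (norm_nonneg _) (by positivity)
    _ = 1 := inv_mul_cancel₀ h0.ne'

/-- Rescaling by the unit `e^{ψ(n)}` reduces this to `ℤ_S`, which `χ` detects. Together with
`chi_mul_eq_one` it identifies the annihilator of `filtration S n`. -/
theorem exists_chi_mul_ne_one {n : ℤ} {ξ : QS S} (hξ : ξ ∉ filtration S (-n)) :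
    ∃ x ∈ filtration S n, chi S (ξ * x) ≠ 1 := by
  have h : ξ * (expPsiUnit S n : QS S) ∉ ZS S := by
    rw [← filtration_zero, mul_comm, ← neg_add_cancel n, expPsiUnit_mul_mem_iff]
    · exact hξ
    · rw [neg_add_cancel, expPsi_neg, expPsi_zero, inv_mul_cancel₀ (expPsi_pos n).ne']
  obtain ⟨z, hz, hne⟩ := exists_chi_ne_one h
  refine ⟨(expPsiUnit S n : QS S) * z, ?_, by rwa [← mul_assoc]⟩
  have := (expPsiUnit_mul_mem_iff (S := S) (m := 0) (n := n) (x := z)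
    (by rw [zero_add, expPsi_zero, one_mul])).2 (by rwa [filtration_zero])
  rwa [zero_add] at this

/-! ### Haar measure -/

instance : (haarQS S).IsAddHaarMeasure := by unfold haarQS; infer_instance

theorem haarQS_ZS : haarQS S (ZS S) = 1 := by
  unfold haarQS
  exact Measure.addHaarMeasure_self (K₀ := ⟨⟨ZS S, isCompact_ZS S⟩, interior_ZS_nonempty S⟩)

theorem haarQS_filtration_lt_top (n : ℤ) : haarQS S (filtration S n) < ⊤ :=
  (isCompact_filtration n).measure_lt_top

/-- Multiplication by `e^{ψ(n)}` scales Haar measure by a constant; comparing `ℤ_S` with its image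
and with its preimage expresses both volumes through that constant. -/
theorem haarQS_filtration_mul (n : ℤ) :
    haarQS S (filtration S n) * haarQS S (filtration S (-n)) = 1 := by
  let e : QS S ≃+ QS S := AddEquiv.mk (Units.mulLeft (expPsiUnit S n)) (fun x y => mul_add _ x y)
  have hc : Continuous e := continuous_const.mul continuous_id
  have hc' : Continuous e.symm := continuous_const.mul continuous_id
  have : (Measure.map e (haarQS S)).IsAddHaarMeasure := e.isAddHaarMeasure_map _ hc hc'
  have key := Measure.isAddLeftInvariant_eq_smul (Measure.map e (haarQS S)) (haarQS S)
  set c := Measure.addHaarScalarFactor (Measure.map e (haarQS S)) (haarQS S)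
  have h1 : haarQS S (filtration S 0) = c * haarQS S (filtration S n) := by
    have := congrArg (fun ν => ν (filtration S n)) key
    simp only [Measure.map_apply hc.measurable (measurableSet_filtration n)] at this
    rw [show e ⁻¹' filtration S n = filtration S 0 by
      ext x
      have := expPsiUnit_mul_mem_iff (S := S) (m := 0) (n := n) (x := x)
        (by rw [zero_add, expPsi_zero, one_mul])
      rw [zero_add] at this
      exact this] at this
    rw [this]; rfl
  have h2 : haarQS S (filtration S (-n)) = c * haarQS S (filtration S 0) := by
    have := congrArg (fun ν => ν (filtration S 0)) key
    simp only [Measure.map_apply hc.measurable (measurableSet_filtration 0)] at this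
    rw [show e ⁻¹' filtration S 0 = filtration S (-n) by
      ext x
      have := expPsiUnit_mul_mem_iff (S := S) (m := -n) (n := n) (x := x)
        (by rw [neg_add_cancel, expPsi_neg, expPsi_zero, inv_mul_cancel₀ (expPsi_pos n).ne'])
      rw [neg_add_cancel] at this
      exact this] at this
    rw [this]; rfl
  rw [filtration_zero, haarQS_ZS] at h1 h2
  rw [h2, mul_one, h1, mul_comm]

/-- Keep the first `v_p(m)` digits of `z`: the truncation is below `p ^ v_p(m)`, which divides `m`
and so is at most `m`. -/
theorem exists_nat_norm_sub_le (p : ℕ) [Fact p.Prime] {m : ℕ} (hm : 0 < m) {z : ℚ_[p]}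
    (hz : ‖z‖ ≤ 1) : ∃ j : Fin m, ‖z - (j : ℕ)‖ ≤ ‖(m : ℚ_[p])‖ := by
  have hm0 : (m : ℚ_[p]) ≠ 0 := by exact_mod_cast hm.ne'
  set Z : ℤ_[p] := ⟨z, hz⟩
  refine ⟨⟨Z.appr (padicValNat p m), (PadicInt.appr_lt _ _).trans_le
    (Nat.le_of_dvd hm pow_padicValNat_dvd)⟩, ?_⟩
  have h := (PadicInt.norm_le_pow_iff_mem_span_pow _ _).2 (PadicInt.appr_spec (padicValNat p m) Z)
  rw [PadicInt.norm_def] at h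
  push_cast at h
  rw [Padic.norm_eq_zpow_neg_valuation hm0, Padic.valuation_natCast]
  simpa using h

/-- A crude volume bound that suffices for the integrability of the heat kernel's symbol. -/
theorem haarQS_filtration_neg_le (n : ℕ) :
    haarQS S (filtration S (-n)) ≤ (expPsiNat S n : ENNReal) ^ S.card := by
  set m := expPsiNat S n with hm
  have hm0 : 0 < m := expPsiNat_pos n
  -- The ball is covered by the `m ^ |S|` translates of `ℤ_S` by vectors with entries `j/m`, `0 ≤ j
  -- < m`.
  have hsub : filtration S (-n) ⊆ ⋃ j : S → Fin m, (fun x : QS S => x +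
      (fun p : S => -(((j p : ℕ) : ℚ_[((p : Nat.Primes) : ℕ)]) / m))) ⁻¹' ZS S := by
    intro x hx
    have hx' := mem_filtration.1 hx
    have hz : ∀ p : S, ‖(m : ℚ_[((p : Nat.Primes) : ℕ)]) * x p‖ ≤ 1 := by
      intro p
      have h0 := norm_pos_iff.2 (expPsi_padic_ne_zero (n : ℤ) p)
      have := hx' p
      rw [expPsi_neg] at this
      push_cast at this
      rw [norm_inv, ← one_div, le_div_iff₀ h0, expPsi_natCast] at this
      rw [norm_mul, mul_comm]
      exact_mod_cast this
    choose j hj using fun p : S => exists_nat_norm_sub_le ((p : Nat.Primes) : ℕ) hm0 (hz p)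
    refine mem_iUnion.2 ⟨j, fun p => ?_⟩
    have hmp : (m : ℚ_[((p : Nat.Primes) : ℕ)]) ≠ 0 := by exact_mod_cast hm0.ne'
    have e : x p + -(((j p : ℕ) : ℚ_[((p : Nat.Primes) : ℕ)]) / m)
        = (m * x p - (j p : ℕ)) / m := by field_simp; ring
    change ‖x p + -(((j p : ℕ) : ℚ_[((p : Nat.Primes) : ℕ)]) / m)‖ ≤ 1
    rw [e, norm_div, div_le_one (norm_pos_iff.2 hmp)]
    exact hj p
  calc _ ≤ _ := measure_mono hsub
    _ ≤ ∑ j : S → Fin m, haarQS S ((fun x : QS S => x +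
      (fun p : S => -(((j p : ℕ) : ℚ_[((p : Nat.Primes) : ℕ)]) / m))) ⁻¹' ZS S) :=
        measure_iUnion_fintype_le _ _
    _ = ∑ j : S → Fin m, 1 := by
        refine Finset.sum_congr rfl fun j _ => ?_
        rw [measure_preimage_add_right, haarQS_ZS]
    _ = _ := by simp

/-- Orthogonality of characters: translation by an element of the subgroup multiplies the integral
by a number different from `1`. -/
theorem integral_filtration_chi_mul_of_notMem {n : ℤ} {ξ : QS S} (hξ : ξ ∉ filtration S (-n)) :
    ∫ x in filtration S n, chi S (ξ * x) ∂haarQS S = 0 := by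
  obtain ⟨a, ha, hne⟩ := exists_chi_mul_ne_one hξ
  set I := ∫ x in filtration S n, chi S (ξ * x) ∂haarQS S with hI
  have h : I = chi S (ξ * a) * I := by
    rw [hI, ← integral_const_mul, ← integral_indicator (measurableSet_filtration n),
      ← integral_indicator (measurableSet_filtration n),
      ← integral_add_left_eq_self _ a]
    refine integral_congr_ae (Filter.Eventually.of_forall fun x => ?_)
    have : a + x ∈ filtration S n ↔ x ∈ filtration S n :=
      ⟨fun h => by simpa using add_mem_filtration (neg_mem_filtration ha) h, add_mem_filtration ha⟩
    by_cases hx : x ∈ filtration S n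
    · simp only [indicator_of_mem (this.2 hx), indicator_of_mem hx, mul_add, chi_add]
    · simp only [indicator_of_notMem (mt this.1 hx), indicator_of_notMem hx]
  have h2 : (chi S (ξ * a) - 1) * I = 0 := by rw [sub_mul, ← h, one_mul, sub_self]
  exact (mul_eq_zero.1 h2).resolve_left (sub_ne_zero.2 hne)

theorem integral_filtration_chi_mul (n : ℤ) (ξ : QS S) :
    ∫ x in filtration S n, chi S (ξ * x) ∂haarQS S =
      (filtration S (-n)).indicator (fun _ => ((haarQS S).real (filtration S n) : ℂ)) ξ := by
  by_cases hξ : ξ ∈ filtration S (-n)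
  · rw [indicator_of_mem hξ, setIntegral_congr_fun (g := fun _ => 1) (measurableSet_filtration n)
      fun x hx => chi_mul_eq_one hξ hx]
    simp
  · rw [indicator_of_notMem hξ, integral_filtration_chi_mul_of_notMem hξ]

/-! ### The norm and the integrability of the heat symbol -/

/-- The supremum defining `order` is attained: the subgroups shrink to `0`, which bounds the set
above, and they exhaust `ℚ_S`, which makes it nonempty. -/
theorem mem_filtration_iff_le_order {x : QS S} (hx : x ≠ 0) (n : ℤ) :
    x ∈ filtration S n ↔ n ≤ order S x := by
  obtain ⟨m, hm⟩ := exists_filtration_subset (isOpen_compl_singleton.mem_nhds hx.symm :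
    ({x}ᶜ : Set (QS S)) ∈ nhds 0)
  obtain ⟨k, hk⟩ := exists_mem_filtration x
  have hbdd : BddAbove {n | x ∈ filtration S n} := by
    refine ⟨m, fun n hn => ?_⟩
    by_contra! hlt
    exact hm (filtration_anti hlt.le hn) rfl
  have hmem : x ∈ filtration S (order S x) := Int.csSup_mem ⟨_, hk⟩ hbdd
  exact ⟨fun h => le_csSup hbdd h, fun h => filtration_anti h hmem⟩

theorem normS_nonneg (x : QS S) : 0 ≤ normS S x := by
  unfold normS
  split_ifs
  · exact le_rfl
  · have := expPsi_pos (S := S) (order S x)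
    positivity

/-- Away from `0` the level sets are differences of consecutive subgroups. The value at `0` is junk,
but it alters a level set by at most one point. -/
theorem measurable_order : Measurable (order S) := by
  refine measurable_to_countable' fun n => ?_
  have : order S ⁻¹' {n} = ((filtration S n \ filtration S (n + 1)) \ {0}) ∪
      (order S ⁻¹' {n} ∩ {0}) := by
    ext x
    by_cases hx : x = 0
    · simp [hx]
    · have h1 := mem_filtration_iff_le_order hx n
      have h2 := mem_filtration_iff_le_order hx (n + 1)
      simp only [mem_preimage, mem_singleton_iff, mem_union, mem_sdiff, mem_inter_iff, hx, h1, h2]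
      constructor <;> intro h <;> grind
  have hs : (order S ⁻¹' {n} ∩ {0}).Subsingleton :=
    subsingleton_singleton.anti inter_subset_right
  rw [this]
  exact (((measurableSet_filtration n).diff (measurableSet_filtration _)).diff
    (measurableSet_singleton (0 : QS S))).union hs.measurableSet

theorem measurable_normS : Measurable (normS S) := by
  unfold normS
  exact Measurable.ite (measurableSet_singleton (0 : QS S)) measurable_const
    ((measurable_from_top (f := fun n : ℤ => ((expPsi S n : ℚ) : ℝ)⁻¹)).comp measurable_order)

theorem normS_of_notMem_ZS {x : QS S} (hx : x ∉ ZS S) :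
    ∃ n : ℕ, x ∈ filtration S (-n) ∧ normS S x = expPsiNat S n := by
  have h0 : x ≠ 0 := fun h => hx (h ▸ zero_mem_ZS)
  rw [← filtration_zero, mem_filtration_iff_le_order h0, not_le] at hx
  obtain ⟨n, hn⟩ := Int.eq_ofNat_of_zero_le (by omega : 0 ≤ -order S x)
  have hn' : order S x = -n := by omega
  refine ⟨n, (mem_filtration_iff_le_order h0 _).2 hn'.ge, ?_⟩
  rw [normS, if_neg h0, hn', expPsi_neg, expPsi_natCast]
  push_cast
  rw [inv_inv]

theorem summable_pow_mul_exp_neg {α t : ℝ} (hα : 0 < α) (ht : 0 < t) (d : ℕ) :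
    Summable fun N : ℕ => (N : ℝ) ^ d * Real.exp (-t * (N : ℝ) ^ α) := by
  -- The exponent is chosen so that `N^d (N^α)^{-(d+2)/α} = N^{-2}`.
  have h1 := (isLittleO_exp_neg_mul_rpow_atTop ht (-((d + 2 : ℝ) / α))).comp_tendsto
    ((tendsto_rpow_atTop hα).comp tendsto_natCast_atTop_atTop)
  have h2 : (fun N : ℕ => (N : ℝ) ^ d * Real.exp (-t * (N : ℝ) ^ α)) =O[Filter.atTop]
      fun N : ℕ => (N : ℝ) ^ (-2 : ℝ) := by
    refine ((Asymptotics.isBigO_refl (fun N : ℕ => (N : ℝ) ^ d) Filter.atTop).mul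
      h1.isBigO).trans_eventuallyEq ?_
    filter_upwards [Filter.eventually_gt_atTop 0] with N hN
    have hN' : (0 : ℝ) < N := by exact_mod_cast hN
    simp only [Function.comp]
    rw [← Real.rpow_mul hN'.le, ← Real.rpow_natCast, ← Real.rpow_add hN']
    congr 1
    field_simp
    ring
  exact summable_of_isBigO_nat (Real.summable_nat_rpow.2 (by norm_num)) h2

/-- Off `ℤ_S` the norm takes natural number values `N`, and its level sets have volume at most `N ^
|S|`; the exponential beats this polynomial growth. -/
theorem integrable_exp_neg_normS {α t : ℝ} (hα : 0 < α) (ht : 0 < t) :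
    Integrable (fun ξ => Real.exp (-t * normS S ξ ^ α)) (haarQS S) := by
  have hmeas : Measurable fun ξ => Real.exp (-t * normS S ξ ^ α) :=
    Real.measurable_exp.comp ((measurable_normS.pow_const α).const_mul (-t))
  refine ⟨hmeas.aestronglyMeasurable, ?_⟩
  rw [hasFiniteIntegral_iff_ofReal (Filter.Eventually.of_forall fun _ => (Real.exp_pos _).le)]
  set g : QS S → ENNReal := fun ξ => ENNReal.ofReal (Real.exp (-t * normS S ξ ^ α))
  set A : ℕ → Set (QS S) := fun N => (ZS S)ᶜ ∩ normS S ⁻¹' {(N : ℝ)}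
  have hA : ∀ N, MeasurableSet (A N) := fun N =>
    isOpen_ZS.measurableSet.compl.inter (measurable_normS (measurableSet_singleton _))
  have hμA : ∀ N, haarQS S (A N) ≤ (N : ENNReal) ^ S.card := by
    intro N
    rcases (A N).eq_empty_or_nonempty with h | ⟨x, hx1, hx2⟩
    · simp [h]
    · obtain ⟨n, hn1, hn2⟩ := normS_of_notMem_ZS hx1
      have hN : expPsiNat S n = N := by
        have : ((expPsiNat S n : ℕ) : ℝ) = N := hn2.symm.trans hx2
        exact_mod_cast this
      refine (measure_mono fun y hy => ?_).trans ((haarQS_filtration_neg_le n).trans_eq (by rw [hN]))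
      -- `ψ` is constant on long stretches, so `y` may come with another index `k`; equal values of
      -- `e^ψ` still give the same ball.
      obtain ⟨k, hk1, hk2⟩ := normS_of_notMem_ZS hy.1
      have hkN : expPsiNat S k = expPsiNat S n := by
        have : ((expPsiNat S k : ℕ) : ℝ) = N := hk2.symm.trans hy.2
        rw [hN]
        exact_mod_cast this
      rw [mem_filtration] at hk1 ⊢
      rwa [expPsi_neg, expPsi_natCast, ← hkN, ← expPsi_natCast, ← expPsi_neg]
  have hcover : (univ : Set (QS S)) ⊆ ZS S ∪ ⋃ N, A N := by
    intro x _
    by_cases hx : x ∈ ZS S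
    · exact Or.inl hx
    · obtain ⟨n, -, hn⟩ := normS_of_notMem_ZS hx
      exact Or.inr (mem_iUnion.2 ⟨expPsiNat S n, hx, hn⟩)
  have hle : ∀ ξ, g ξ ≤ 1 := by
    intro ξ
    rw [← ENNReal.ofReal_one]
    refine ENNReal.ofReal_le_ofReal (Real.exp_le_one_iff.2 ?_)
    have := Real.rpow_nonneg (normS_nonneg ξ) α
    nlinarith
  have h1 : ∫⁻ ξ in ZS S, g ξ ∂haarQS S ≤ 1 := by
    calc _ ≤ ∫⁻ ξ in ZS S, 1 ∂haarQS S := lintegral_mono hle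
      _ = 1 := by simp [haarQS_ZS]
  have h2 : ∀ N : ℕ, ∫⁻ ξ in A N, g ξ ∂haarQS S ≤
      ENNReal.ofReal ((N : ℝ) ^ S.card * Real.exp (-t * (N : ℝ) ^ α)) := by
    intro N
    rw [setLIntegral_congr_fun (g := fun _ => ENNReal.ofReal (Real.exp (-t * (N : ℝ) ^ α))) (hA N)
      (fun ξ hξ => by simp only [g]; rw [show normS S ξ = N from hξ.2]), setLIntegral_const,
      mul_comm, ENNReal.ofReal_mul (by positivity)]
    gcongr
    rw [ENNReal.ofReal_pow (by positivity), ENNReal.ofReal_natCast]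
    exact hμA N
  calc ∫⁻ ξ, g ξ ∂haarQS S = ∫⁻ ξ in univ, g ξ ∂haarQS S := by rw [setLIntegral_univ]
    _ ≤ ∫⁻ ξ in ZS S ∪ ⋃ N, A N, g ξ ∂haarQS S := lintegral_mono_set hcover
    _ ≤ ∫⁻ ξ in ZS S, g ξ ∂haarQS S + ∫⁻ ξ in ⋃ N, A N, g ξ ∂haarQS S := lintegral_union_le _ _ _
    _ ≤ 1 + ∑' N, ∫⁻ ξ in A N, g ξ ∂haarQS S := add_le_add h1 (lintegral_iUnion_le _ _)
    _ ≤ 1 + ∑' N : ℕ, ENNReal.ofReal ((N : ℝ) ^ S.card * Real.exp (-t * (N : ℝ) ^ α)) := by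
        gcongr with N; exact h2 N
    _ < ⊤ := by
        rw [← ENNReal.ofReal_tsum_of_nonneg (fun N => by positivity)
          (summable_pow_mul_exp_neg hα ht _)]
        exact ENNReal.add_lt_top.2 ⟨ENNReal.one_lt_top, ENNReal.ofReal_lt_top⟩

/-! ### Bruhat-Schwartz functions and the Fourier integral -/

/-- Locally constant functions of compact support. -/
structure IsBruhatSchwartz (φ : QS S → ℂ) : Prop where
  isLocallyConstant : IsLocallyConstant φ
  hasCompactSupport : HasCompactSupport φ

theorem IsBruhatSchwartz.continuous {φ : QS S → ℂ} (h : IsBruhatSchwartz φ) : Continuous φ :=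
  h.isLocallyConstant.continuous

theorem IsBruhatSchwartz.integrable {φ : QS S → ℂ} (h : IsBruhatSchwartz φ) :
    Integrable φ (haarQS S) :=
  h.continuous.integrable_of_hasCompactSupport h.hasCompactSupport

theorem IsBruhatSchwartz.memLp {φ : QS S → ℂ} (h : IsBruhatSchwartz φ) :
    MemLp φ 2 (haarQS S) :=
  h.continuous.memLp_of_hasCompactSupport h.hasCompactSupport

theorem isLocallyConstant_of_invariant {φ : QS S → ℂ} {n : ℤ}
    (h : ∀ x, ∀ b ∈ filtration S n, φ (x + b) = φ x) : IsLocallyConstant φ := by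
  refine (IsLocallyConstant.iff_eventually_eq _).2 fun x => ?_
  have hc : Filter.Tendsto (fun y => y - x) (nhds x) (nhds 0) := by
    have : Continuous fun y : QS S => y - x := by fun_prop
    simpa using this.tendsto x
  filter_upwards [hc ((isOpen_filtration n).mem_nhds (zero_mem_filtration n))] with y hy
  have := h x (y - x) hy
  rwa [add_sub_cancel] at this

theorem isBruhatSchwartz_of_invariant {φ : QS S → ℂ} {n m : ℤ}
    (h : ∀ x, ∀ b ∈ filtration S n, φ (x + b) = φ x) (h' : ∀ x ∉ filtration S m, φ x = 0) :
    IsBruhatSchwartz φ :=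
  ⟨isLocallyConstant_of_invariant h, HasCompactSupport.intro (isCompact_filtration m) h'⟩

theorem IsBruhatSchwartz.exists_invariant {φ : QS S → ℂ} (h : IsBruhatSchwartz φ) :
    ∃ n : ℤ, ∀ x, ∀ b ∈ filtration S n, φ (x + b) = φ x := by
  have key : ∃ n : ℤ, ∀ x ∈ tsupport φ, ∀ b ∈ filtration S n, φ (x + b) = φ x := by
    refine h.hasCompactSupport.isCompact.induction_on
      (p := fun s => ∃ n : ℤ, ∀ x ∈ s, ∀ b ∈ filtration S n, φ (x + b) = φ x) ⟨0, by simp⟩ ?_ ?_ ?_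
    · rintro s t hst ⟨n, hn⟩
      exact ⟨n, fun x hx => hn x (hst hx)⟩
    · rintro s t ⟨n, hn⟩ ⟨m, hm⟩
      refine ⟨max n m, fun x hx b hb => ?_⟩
      rcases hx with hx | hx
      · exact hn x hx b (filtration_anti (le_max_left _ _) hb)
      · exact hm x hx b (filtration_anti (le_max_right _ _) hb)
    · intro x _
      have h1 := (IsLocallyConstant.iff_eventually_eq _).1 h.isLocallyConstant x
      have h2 : Filter.Tendsto (fun b => x + b) (nhds 0) (nhds x) := by
        have : Continuous fun b : QS S => x + b := by fun_prop
        simpa using this.tendsto 0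
      obtain ⟨n, hn⟩ := exists_filtration_subset (h2 h1)
      have h3 : Filter.Tendsto (fun y => y - x) (nhds x) (nhds 0) := by
        have : Continuous fun y : QS S => y - x := by fun_prop
        simpa using this.tendsto x
      refine ⟨(fun y => y - x) ⁻¹' filtration S n, mem_nhdsWithin_of_mem_nhds
        (h3 ((isOpen_filtration n).mem_nhds (zero_mem_filtration n))), n, fun y hy b hb => ?_⟩
      have e1 : φ (x + (y - x)) = φ x := hn hy
      have e2 : φ (x + (y - x + b)) = φ x := hn (add_mem_filtration hy hb)
      rw [add_sub_cancel] at e1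
      rw [← add_assoc, add_sub_cancel] at e2
      rw [e1, e2]
  obtain ⟨n, hn⟩ := key
  refine ⟨n, fun x b hb => ?_⟩
  by_cases hx : x ∈ tsupport φ
  · exact hn x hx b hb
  -- Invariance is known only at points of the support; if translation enters the support from
  -- outside, apply it at `x + b` with `-b`.
  by_cases hxb : x + b ∈ tsupport φ
  · have := hn _ hxb (-b) (neg_mem_filtration hb)
    rw [← this, add_neg_cancel_right]
  · rw [image_eq_zero_of_notMem_tsupport hx, image_eq_zero_of_notMem_tsupport hxb]

theorem IsBruhatSchwartz.exists_support {φ : QS S → ℂ} (h : IsBruhatSchwartz φ) :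
    ∃ m : ℤ, ∀ x ∉ filtration S (-m), φ x = 0 := by
  obtain ⟨m, hm⟩ := exists_subset_filtration h.hasCompactSupport.isCompact
  exact ⟨m, fun x hx => image_eq_zero_of_notMem_tsupport fun h => hx (hm h)⟩

theorem isBruhatSchwartz_indicator {C : Set (QS S)} (hC : IsCompact C) (hC' : IsOpen C) :
    IsBruhatSchwartz (C.indicator fun _ => (1 : ℂ)) where
  isLocallyConstant :=
    ((LocallyConstant.const (QS S) (1 : ℂ)).indicator ⟨hC.isClosed, hC'⟩).isLocallyConstant
  hasCompactSupport := HasCompactSupport.intro hC fun _ hx => indicator_of_notMem hx _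

theorem IsBruhatSchwartz.comp_neg {φ : QS S → ℂ} (h : IsBruhatSchwartz φ) :
    IsBruhatSchwartz fun x => φ (-x) where
  isLocallyConstant := h.isLocallyConstant.comp_continuous continuous_neg
  hasCompactSupport := h.hasCompactSupport.comp_homeomorph (Homeomorph.neg _)

/-- The inverse Fourier integral. -/
noncomputable def invFourierInt (S : Finset Nat.Primes) (G : QS S → ℂ) (x : QS S) : ℂ :=
  ∫ ξ, chi S (-(x * ξ)) * G ξ ∂haarQS S

theorem integrable_mul_chi {φ : QS S → ℂ} (h : Integrable φ (haarQS S)) (ξ : QS S) :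
    Integrable (fun x => φ x * chi S (ξ * x)) (haarQS S) := by
  refine h.mul_bdd (c := 1) ?_ (Filter.Eventually.of_forall fun x => (norm_chi _).le)
  exact (continuous_chi.comp (by fun_prop)).aestronglyMeasurable

theorem integrable_chi_mul {φ : QS S → ℂ} (h : Integrable φ (haarQS S)) (x : QS S) :
    Integrable (fun ξ => chi S (-(x * ξ)) * φ ξ) (haarQS S) := by
  refine h.bdd_mul (c := 1) ?_ (Filter.Eventually.of_forall fun x => (norm_chi _).le)
  exact (continuous_chi.comp (by fun_prop)).aestronglyMeasurable

theorem fourierInt_eq_zero_of_invariant {φ : QS S → ℂ} {n : ℤ}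
    (hn : ∀ x, ∀ b ∈ filtration S n, φ (x + b) = φ x) {ξ : QS S} (hξ : ξ ∉ filtration S (-n)) :
    fourierInt S φ ξ = 0 := by
  obtain ⟨b, hb, hne⟩ := exists_chi_mul_ne_one hξ
  have : fourierInt S φ ξ = chi S (ξ * b) * fourierInt S φ ξ := by
    unfold fourierInt
    rw [← integral_const_mul, ← integral_add_right_eq_self _ b]
    refine integral_congr_ae (Filter.Eventually.of_forall fun x => ?_)
    simp only
    rw [hn x b hb, mul_add, chi_add]
    ring
  have h2 : (chi S (ξ * b) - 1) * fourierInt S φ ξ = 0 := by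
    rw [sub_mul, ← this, one_mul, sub_self]
  exact (mul_eq_zero.1 h2).resolve_left (sub_ne_zero.2 hne)

/-- By duality, invariance of `φ` bounds the support of the transform, and the support of `φ` gives
invariance of the transform. -/
theorem IsBruhatSchwartz.fourierInt {φ : QS S → ℂ} (h : IsBruhatSchwartz φ) :
    IsBruhatSchwartz (fourierInt S φ) := by
  obtain ⟨n, hn⟩ := h.exists_invariant
  obtain ⟨m, hm⟩ := h.exists_support
  refine isBruhatSchwartz_of_invariant (n := m) (m := -n) (fun ξ η hη => ?_) fun ξ hξ => ?_
  · refine integral_congr_ae (Filter.Eventually.of_forall fun x => ?_)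
    by_cases hx : x ∈ filtration S (-m)
    · simp only
      rw [add_mul, chi_add, mul_comm η x, chi_mul_eq_one hx hη, mul_one]
    · simp only [hm x hx, zero_mul]
  · exact fourierInt_eq_zero_of_invariant hn hξ

/-- Fourier inversion for Bruhat-Schwartz functions. -/
theorem IsBruhatSchwartz.invFourierInt_fourierInt {φ : QS S → ℂ} (h : IsBruhatSchwartz φ)
    (x : QS S) : invFourierInt S (SAdic.fourierInt S φ) x = φ x := by
  obtain ⟨n, hn⟩ := h.exists_invariant
  have h1 : ∀ ξ, chi S (-(x * ξ)) * SAdic.fourierInt S φ ξ =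
      (filtration S (-n)).indicator
        (fun ξ => ∫ y, φ y * chi S ((y - x) * ξ) ∂haarQS S) ξ := by
    intro ξ
    by_cases hξ : ξ ∈ filtration S (-n)
    · rw [indicator_of_mem hξ, SAdic.fourierInt, ← integral_const_mul]
      refine integral_congr_ae (Filter.Eventually.of_forall fun y => ?_)
      simp only
      rw [show (y - x) * ξ = -(x * ξ) + ξ * y by ring, chi_add]
      ring
    · rw [indicator_of_notMem hξ, fourierInt_eq_zero_of_invariant hn hξ, mul_zero]
  have hfin : IsFiniteMeasure ((haarQS S).restrict (filtration S (-n))) :=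
    ⟨by rw [Measure.restrict_apply_univ]; exact haarQS_filtration_lt_top _⟩
  simp only [invFourierInt, h1]
  rw [integral_indicator (measurableSet_filtration _), integral_integral_swap]
  · simp only [integral_const_mul, integral_filtration_chi_mul, neg_neg]
    -- The frequency integral over the ball is a multiple of the indicator of `x + filtration S n`,
    -- where `φ` is constantly `φ x`; the two volumes then cancel.
    have h2 : ∀ y, φ y * (filtration S n).indicator
        (fun _ => ((haarQS S).real (filtration S (-n)) : ℂ)) (y - x) =
        (fun z => (filtration S n).indicator
          (fun _ => φ x * ((haarQS S).real (filtration S (-n)) : ℂ)) z) (y - x) := by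
      intro y
      by_cases hy : y - x ∈ filtration S n
      · have := hn x _ hy
        rw [add_sub_cancel] at this
        simp only [indicator_of_mem hy, this]
      · simp only [indicator_of_notMem hy, mul_zero]
    simp only [h2]
    rw [integral_sub_right_eq_self, integral_indicator (measurableSet_filtration _),
      setIntegral_const]
    have hv := congrArg ENNReal.toReal (haarQS_filtration_mul (S := S) n)
    rw [ENNReal.toReal_mul, ENNReal.toReal_one] at hv
    rw [Complex.real_smul, mul_left_comm, ← Complex.ofReal_mul]
    simp only [Measure.real, hv, Complex.ofReal_one, mul_one]
  · have := (((integrable_const (1 : ℂ)) :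
        Integrable _ ((haarQS S).restrict (filtration S (-n)))).mul_prod h.integrable).bdd_mul (c := 1)
      (f := fun z : QS S × QS S => chi S ((z.2 - x) * z.1))
      (continuous_chi.comp (by fun_prop)).aestronglyMeasurable
      (Filter.Eventually.of_forall fun x => (norm_chi _).le)
    refine this.congr (Filter.Eventually.of_forall fun z => ?_)
    simp only [Function.uncurry]
    ring

/-- The multiplication formula. -/
theorem integral_conj_fourierInt_mul {φ G : QS S → ℂ} (hφ : Integrable φ (haarQS S))
    (hG : Integrable G (haarQS S)) :
    ∫ ξ, starRingEnd ℂ (fourierInt S φ ξ) * G ξ ∂haarQS S =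
      ∫ x, starRingEnd ℂ (φ x) * invFourierInt S G x ∂haarQS S := by
  have h1 : ∀ ξ, starRingEnd ℂ (fourierInt S φ ξ) * G ξ =
      ∫ x, starRingEnd ℂ (φ x) * chi S (-(x * ξ)) * G ξ ∂haarQS S := by
    intro ξ
    rw [integral_mul_const, fourierInt, ← integral_conj]
    simp only [map_mul, conj_chi, mul_comm ξ]
  have h2 : ∀ x, starRingEnd ℂ (φ x) * invFourierInt S G x =
      ∫ ξ, starRingEnd ℂ (φ x) * chi S (-(x * ξ)) * G ξ ∂haarQS S := by
    intro x
    rw [invFourierInt, ← integral_const_mul]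
    simp only [mul_assoc]
  simp only [h1, h2]
  refine integral_integral_swap ?_
  have hφ' : Integrable (fun x => starRingEnd ℂ (φ x)) (haarQS S) :=
    (LinearIsometryEquiv.integrable_comp_iff Complex.conjLIE).2 hφ
  have := (hG.mul_prod hφ').bdd_mul (c := 1) (f := fun z : QS S × QS S => chi S (-(z.2 * z.1)))
    (continuous_chi.comp (by fun_prop)).aestronglyMeasurable
    (Filter.Eventually.of_forall fun x => (norm_chi _).le)
  refine this.congr (Filter.Eventually.of_forall fun z => ?_)
  simp only [Function.uncurry]
  ring

-- A compact `K` is the decreasing intersection of the compact open sets `K + filtration S n`, so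
-- integrals over `K` are limits of vanishing ones.
open scoped Pointwise in
theorem ae_eq_zero_of_forall_compact_open {h : QS S → ℂ} (hh : LocallyIntegrable h (haarQS S))
    (h0 : ∀ C, IsCompact C → IsOpen C → ∫ x in C, h x ∂haarQS S = 0) : h =ᵐ[haarQS S] 0 := by
  refine ae_eq_zero_of_forall_setIntegral_isCompact_eq_zero' hh fun K hK => ?_
  set C : ℕ → Set (QS S) := fun n => K + filtration S n
  have hCo : ∀ n, IsOpen (C n) := fun n => (isOpen_filtration _).add_left
  have hCc : ∀ n, IsCompact (C n) := fun n => hK.add (isCompact_filtration _)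
  have hanti : Antitone C := fun m n hmn =>
    add_subset_add_left (filtration_anti (by exact_mod_cast hmn))
  have hInter : ⋂ n, C n = K := by
    refine Subset.antisymm (fun x hx => ?_) (subset_iInter fun n x hx =>
      ⟨x, hx, 0, zero_mem_filtration _, add_zero x⟩)
    by_contra hxK
    have hc : Filter.Tendsto (fun b => x - b) (nhds 0) (nhds x) := by
      have : Continuous fun b : QS S => x - b := by fun_prop
      simpa using this.tendsto 0
    obtain ⟨n, hn⟩ := exists_filtration_subset (hc (hK.isClosed.isOpen_compl.mem_nhds hxK))
    obtain ⟨k, hk, b, hb, hkb⟩ := mem_iInter.1 hx n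
    have : x - b ∈ Kᶜ := hn hb
    rw [← hkb] at this
    simp [hk] at this
  have hlim := tendsto_setIntegral_of_antitone (fun n => (hCo n).measurableSet) hanti
    ⟨0, hh.integrableOn_isCompact (hCc 0)⟩
  rw [hInter] at hlim
  refine tendsto_nhds_unique hlim ?_
  simp only [h0 _ (hCc _) (hCo _)]
  exact tendsto_const_nhds

/-! ### The unitary Fourier transform -/

theorem L2_inner_eq (f g : L2 S) :
    inner ℂ f g = ∫ x, starRingEnd ℂ (f x) * g x ∂haarQS S := by
  rw [L2.inner_def]
  simp only [RCLike.inner_apply, mul_comm]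

theorem fourierInt_add {φ ψ : QS S → ℂ} (hφ : Integrable φ (haarQS S))
    (hψ : Integrable ψ (haarQS S)) :
    fourierInt S (φ + ψ) = fourierInt S φ + fourierInt S ψ := by
  ext ξ
  simp only [fourierInt, Pi.add_apply, add_mul]
  exact integral_add (integrable_mul_chi hφ ξ) (integrable_mul_chi hψ ξ)

theorem fourierInt_smul (c : ℂ) (φ : QS S → ℂ) :
    fourierInt S (c • φ) = c • fourierInt S φ := by
  ext ξ
  simp only [fourierInt, Pi.smul_apply, smul_eq_mul, mul_assoc]
  exact integral_const_mul _ _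

/-- The generating pairs already form a subspace, so the span adds nothing and Parseval need only be
checked on single functions. -/
theorem exists_isBruhatSchwartz_of_mem_span {q : L2 S × L2 S}
    (hq : q ∈ Submodule.span ℂ {q : L2 S × L2 S | ∃ φ : QS S → ℂ, IsLocallyConstant φ ∧
      HasCompactSupport φ ∧ q.1 =ᵐ[haarQS S] φ ∧ q.2 =ᵐ[haarQS S] fourierInt S φ}) :
    ∃ φ : QS S → ℂ, IsBruhatSchwartz φ ∧ q.1 =ᵐ[haarQS S] φ ∧
      q.2 =ᵐ[haarQS S] fourierInt S φ := by
  induction hq using Submodule.span_induction with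
  | mem q h =>
    obtain ⟨φ, h1, h2, h3, h4⟩ := h
    exact ⟨φ, ⟨h1, h2⟩, h3, h4⟩
  | zero =>
    refine ⟨0, ⟨IsLocallyConstant.const 0, HasCompactSupport.zero⟩, Lp.coeFn_zero _ _ _, ?_⟩
    have : fourierInt S 0 = 0 := by ext ξ; simp [fourierInt]
    rw [this]
    exact Lp.coeFn_zero _ _ _
  | add q r _ _ hq hr =>
    obtain ⟨φ, h1, h2, h3⟩ := hq
    obtain ⟨ψ, k1, k2, k3⟩ := hr
    refine ⟨φ + ψ, ⟨h1.1.add k1.1, h1.2.add k1.2⟩, (Lp.coeFn_add _ _).trans (h2.add k2), ?_⟩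
    rw [fourierInt_add h1.integrable k1.integrable]
    exact (Lp.coeFn_add _ _).trans (h3.add k3)
  | smul c q _ hq =>
    obtain ⟨φ, h1, h2, h3⟩ := hq
    refine ⟨c • φ, ⟨h1.1.comp (c • ·), h1.2.smul_left (f := fun _ => c)⟩,
      (Lp.coeFn_smul _ _).trans (h2.const_smul c), ?_⟩
    rw [fourierInt_smul]
    exact (Lp.coeFn_smul _ _).trans (h3.const_smul c)

/-- Parseval for Bruhat-Schwartz functions is the multiplication formula combined with inversion;
equality of norms is a closed condition and passes to the closure. -/
theorem norm_eq_of_isFourier {f F : L2 S} (h : IsFourier S f F) : ‖f‖ = ‖F‖ := by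
  have hcl : IsClosed {q : L2 S × L2 S | ‖q.1‖ = ‖q.2‖} :=
    isClosed_eq continuous_fst.norm continuous_snd.norm
  rw [IsFourier, fourierGraph, ← SetLike.mem_coe, Submodule.topologicalClosure_coe] at h
  refine (closure_minimal ?_ hcl h : (f, F) ∈ {q : L2 S × L2 S | ‖q.1‖ = ‖q.2‖})
  intro q hq
  obtain ⟨φ, hφ, h1, h2⟩ := exists_isBruhatSchwartz_of_mem_span hq
  have key : inner ℂ q.1 q.1 = inner ℂ q.2 q.2 := by
    rw [L2_inner_eq, L2_inner_eq]
    calc _ = ∫ x, starRingEnd ℂ (φ x) * φ x ∂haarQS S :=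
          integral_congr_ae (by filter_upwards [h1] with x hx; rw [hx])
      _ = ∫ x, starRingEnd ℂ (φ x) * invFourierInt S (fourierInt S φ) x ∂haarQS S := by
          simp only [hφ.invFourierInt_fourierInt]
      _ = _ := (integral_conj_fourierInt_mul hφ.integrable hφ.fourierInt.integrable).symm
      _ = _ := integral_congr_ae (by filter_upwards [h2] with x hx; rw [hx])
  rw [inner_self_eq_norm_sq_to_K, inner_self_eq_norm_sq_to_K] at key
  have key' : ‖q.1‖ ^ 2 = ‖q.2‖ ^ 2 := by exact_mod_cast key
  exact (pow_left_inj₀ (norm_nonneg _) (norm_nonneg _) two_ne_zero).1 key'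

theorem IsBruhatSchwartz.isFourier {φ : QS S → ℂ} (h : IsBruhatSchwartz φ) :
    IsFourier S (h.memLp.toLp φ) (h.fourierInt.memLp.toLp _) :=
  Submodule.le_topologicalClosure _ (Submodule.subset_span
    ⟨φ, h.1, h.2, h.memLp.coeFn_toLp, h.fourierInt.memLp.coeFn_toLp⟩)

/-- Bruhat-Schwartz functions separate the elements of `L²`. -/
theorem eq_zero_of_forall_inner_isBruhatSchwartz {g : L2 S}
    (h : ∀ (φ : QS S → ℂ) (_ : IsBruhatSchwartz φ),
      ∫ x, starRingEnd ℂ (φ x) * g x ∂haarQS S = 0) : g = 0 := by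
  rw [Lp.eq_zero_iff_ae_eq_zero]
  refine ae_eq_zero_of_forall_compact_open ((Lp.memLp g).locallyIntegrable (by norm_num))
    fun C hC hC' => ?_
  rw [← h _ (isBruhatSchwartz_indicator hC hC'), ← integral_indicator hC'.measurableSet]
  refine integral_congr_ae (Filter.Eventually.of_forall fun x => ?_)
  by_cases hx : x ∈ C <;> simp [hx]

theorem eq_top_of_isBruhatSchwartz_mem {M : Submodule ℂ (L2 S)} (hM : IsClosed (M : Set (L2 S)))
    (h : ∀ (φ : QS S → ℂ) (hφ : IsBruhatSchwartz φ), hφ.memLp.toLp φ ∈ M) : M = ⊤ := by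
  have : CompleteSpace M := hM.completeSpace_coe
  rw [← Submodule.orthogonal_eq_bot_iff, Submodule.eq_bot_iff]
  intro g hg
  refine eq_zero_of_forall_inner_isBruhatSchwartz fun φ hφ => ?_
  have := (Submodule.mem_orthogonal M g).1 hg _ (h φ hφ)
  rw [L2_inner_eq] at this
  rw [← this]
  exact integral_congr_ae (by filter_upwards [hφ.memLp.coeFn_toLp] with x hx; rw [hx])

/-- The first projection of the Fourier graph. -/
noncomputable def fourierGraphFst (S : Finset Nat.Primes) : fourierGraph S →ₗᵢ[ℂ] L2 S where
  toLinearMap := (LinearMap.fst ℂ _ _).comp (fourierGraph S).subtype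
  norm_map' q := by
    have := norm_eq_of_isFourier q.2
    change ‖(q : L2 S × L2 S).1‖ = ‖(q : L2 S × L2 S)‖
    rw [Prod.norm_def, ← this, max_self]

/-- The second projection of the Fourier graph. -/
noncomputable def fourierGraphSnd (S : Finset Nat.Primes) : fourierGraph S →ₗᵢ[ℂ] L2 S where
  toLinearMap := (LinearMap.snd ℂ _ _).comp (fourierGraph S).subtype
  norm_map' q := by
    have := norm_eq_of_isFourier q.2
    change ‖(q : L2 S × L2 S).2‖ = ‖(q : L2 S × L2 S)‖
    rw [Prod.norm_def, this, max_self]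

instance : CompleteSpace (fourierGraph S) :=
  (Submodule.isClosed_topologicalClosure _).completeSpace_coe

/-- The range of an isometry of a complete space is closed, and it contains the Bruhat-Schwartz
functions, which are dense. -/
theorem fourierGraphFst_surjective : Function.Surjective (fourierGraphFst S) := by
  refine LinearMap.range_eq_top.1 (eq_top_of_isBruhatSchwartz_mem
    (M := LinearMap.range (fourierGraphFst S).toLinearMap) ?_ fun φ hφ => ?_)
  · exact (fourierGraphFst S).isometry.isClosedEmbedding.isClosed_range
  · exact ⟨⟨_, hφ.isFourier⟩, rfl⟩

/-- Every Bruhat-Schwartz function is thus itself a transform, which makes the range of the second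
projection dense. -/
theorem fourierInt_invFourier {φ : QS S → ℂ} (h : IsBruhatSchwartz φ) :
    fourierInt S (fun x => fourierInt S φ (-x)) = φ := by
  ext ξ
  rw [← h.invFourierInt_fourierInt ξ, fourierInt, invFourierInt,
    ← integral_neg_eq_self (fun x => fourierInt S φ (-x) * chi S (ξ * x))]
  simp only [neg_neg, mul_neg, mul_comm]

theorem fourierGraphSnd_surjective : Function.Surjective (fourierGraphSnd S) := by
  refine LinearMap.range_eq_top.1 (eq_top_of_isBruhatSchwartz_mem
    (M := LinearMap.range (fourierGraphSnd S).toLinearMap) ?_ fun φ hφ => ?_)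
  · exact (fourierGraphSnd S).isometry.isClosedEmbedding.isClosed_range
  · refine ⟨⟨_, hφ.fourierInt.comp_neg.isFourier⟩, ?_⟩
    exact MemLp.toLp_congr hφ.fourierInt.comp_neg.fourierInt.memLp hφ.memLp (by rw [fourierInt_invFourier hφ])

/-- The unitary Fourier transform on `L²(ℚ_S)`. -/
noncomputable def fourierL2 (S : Finset Nat.Primes) : L2 S ≃ₗᵢ[ℂ] L2 S :=
  (LinearIsometryEquiv.ofSurjective _ fourierGraphFst_surjective).symm.trans
    (LinearIsometryEquiv.ofSurjective _ fourierGraphSnd_surjective)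

theorem isFourier_iff {f F : L2 S} : IsFourier S f F ↔ fourierL2 S f = F := by
  have key : ∀ q : fourierGraph S,
      fourierL2 S (q : L2 S × L2 S).1 = (q : L2 S × L2 S).2 := by
    intro q
    change (LinearIsometryEquiv.ofSurjective _ fourierGraphSnd_surjective)
      ((LinearIsometryEquiv.ofSurjective _ fourierGraphFst_surjective).symm
        ((LinearIsometryEquiv.ofSurjective _ fourierGraphFst_surjective) q)) = _
    rw [LinearIsometryEquiv.symm_apply_apply]
    rfl
  constructor
  · exact fun h => key ⟨_, h⟩
  · rintro rfl
    obtain ⟨q, rfl⟩ := fourierGraphFst_surjective f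
    have := key q
    change IsFourier S (q : L2 S × L2 S).1 (fourierL2 S (q : L2 S × L2 S).1)
    rw [this]
    exact q.2

theorem continuous_invFourierInt {G : QS S → ℂ} (hG : Integrable G (haarQS S)) :
    Continuous (invFourierInt S G) := by
  refine continuous_of_dominated (bound := fun ξ => ‖G ξ‖)
    (fun x => (integrable_chi_mul hG x).aestronglyMeasurable)
    (fun x => Filter.Eventually.of_forall fun ξ => ?_) hG.norm
    (Filter.Eventually.of_forall fun ξ => ?_)
  · rw [norm_mul, norm_chi, one_mul]
  · exact (continuous_chi.comp (by fun_prop)).mul continuous_const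

/-- On `L¹ ∩ L²`, the inverse Fourier transform is given by the Fourier integral. -/
theorem fourierL2_symm_ae_eq {G : L2 S} (hG : Integrable G (haarQS S)) :
    (fourierL2 S).symm G =ᵐ[haarQS S] invFourierInt S G := by
  have hcont := continuous_invFourierInt hG
  set g := (fourierL2 S).symm G with hg
  have hgl : LocallyIntegrable g (haarQS S) := (Lp.memLp g).locallyIntegrable (by norm_num)
  have h := ae_eq_zero_of_forall_compact_open (h := fun x => g x - invFourierInt S G x)
    (hgl.sub hcont.locallyIntegrable) fun C hC hC' => ?_
  · filter_upwards [h] with x hx using sub_eq_zero.1 hx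
  rw [integral_sub (hgl.integrableOn_isCompact hC)
    (hcont.locallyIntegrable.integrableOn_isCompact hC), sub_eq_zero]
  have hφ := isBruhatSchwartz_indicator hC hC'
  set φ := C.indicator fun _ => (1 : ℂ)
  have hind : ∀ u : QS S → ℂ, ∫ x, starRingEnd ℂ (φ x) * u x ∂haarQS S =
      ∫ x in C, u x ∂haarQS S := by
    intro u
    rw [← integral_indicator hC'.measurableSet]
    refine integral_congr_ae (Filter.Eventually.of_forall fun x => ?_)
    by_cases hx : x ∈ C <;> simp [φ, hx]
  -- Both integrals become pairings with the transform of `φ`: one by unitarity of `fourierL2`, the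
  -- other by the multiplication formula.
  rw [← hind, ← hind, ← integral_conj_fourierInt_mul hφ.integrable hG]
  have e := (fourierL2 S).inner_map_map (hφ.memLp.toLp φ) g
  rw [isFourier_iff.1 hφ.isFourier, hg, LinearIsometryEquiv.apply_symm_apply, L2_inner_eq,
    L2_inner_eq] at e
  refine Eq.trans ?_ (e.symm.trans ?_)
  · exact integral_congr_ae (by filter_upwards [hφ.memLp.coeFn_toLp] with x hx; rw [hx])
  · exact integral_congr_ae (by filter_upwards [hφ.fourierInt.memLp.coeFn_toLp] with x hx; rw [hx])

/-! ### Duhamel's principle in a Hilbert space -/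

section Interval

variable {X : Type*} [NormedAddCommGroup X] [NormedSpace ℝ X]

theorem integral_eq_integral_indicator_triangle {s t : ℝ} (hs : s ∈ Ioc 0 t) (k : ℝ → ℝ → X) :
    ∫ r in s..t, k r s = ∫ r in Ioc 0 t,
      {p : ℝ × ℝ | p.2 ≤ p.1}.indicator (Function.uncurry k) (r, s) := by
  rw [intervalIntegral.integral_of_le hs.2]
  have : ∀ r, {p : ℝ × ℝ | p.2 ≤ p.1}.indicator (Function.uncurry k) (r, s)
      = (Ici s).indicator (fun r => k r s) r := fun r => by simp [indicator, Function.uncurry]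
  simp only [this]
  rw [setIntegral_indicator measurableSet_Ici, ← integral_Icc_eq_integral_Ioc]
  congr 2
  ext r
  simp only [mem_Ioc, mem_inter_iff, mem_Ici, mem_Icc]
  constructor
  · intro h; exact ⟨⟨hs.1.trans_le h.1, h.2⟩, h.1⟩
  · intro h; exact ⟨h.2, h.1.2⟩

theorem intervalIntegrable_triangle {t : ℝ} (ht : 0 ≤ t) {k : ℝ → ℝ → X}
    (hk : Integrable (Function.uncurry k)
      ((volume.restrict (Ioc 0 t)).prod (volume.restrict (Ioc 0 t)))) :
    IntervalIntegrable (fun s => ∫ r in s..t, k r s) volume 0 t := by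
  have hm : MeasurableSet {p : ℝ × ℝ | p.2 ≤ p.1} := measurableSet_le measurable_snd measurable_fst
  rw [intervalIntegrable_iff_integrableOn_Ioc_of_le ht]
  refine (hk.indicator hm).integral_prod_right.congr ?_
  filter_upwards [ae_restrict_mem measurableSet_Ioc] with s hs
  exact (integral_eq_integral_indicator_triangle hs k).symm

/-- Fubini's theorem on a triangle. -/
theorem integral_triangle_swap {t : ℝ} (ht : 0 ≤ t) {k : ℝ → ℝ → X}
    (hk : Integrable (Function.uncurry k)
      ((volume.restrict (Ioc 0 t)).prod (volume.restrict (Ioc 0 t)))) :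
    ∫ r in 0..t, ∫ s in 0..r, k r s = ∫ s in 0..t, ∫ r in s..t, k r s := by
  set μ := volume.restrict (Ioc 0 t)
  have hm : MeasurableSet {p : ℝ × ℝ | p.2 ≤ p.1} := measurableSet_le measurable_snd measurable_fst
  have h1 : ∫ r in 0..t, ∫ s in 0..r, k r s =
      ∫ r, ∫ s, {p : ℝ × ℝ | p.2 ≤ p.1}.indicator (Function.uncurry k) (r, s) ∂μ ∂μ := by
    rw [intervalIntegral.integral_of_le ht]
    refine setIntegral_congr_fun measurableSet_Ioc fun r hr => ?_
    rw [intervalIntegral.integral_of_le hr.1.le]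
    have : ∀ s, {p : ℝ × ℝ | p.2 ≤ p.1}.indicator (Function.uncurry k) (r, s)
        = (Iic r).indicator (k r) s := fun s => by simp [indicator, Function.uncurry]
    simp only [this]
    rw [setIntegral_indicator measurableSet_Iic]
    congr 2
    ext s
    simp only [mem_Ioc, mem_inter_iff, mem_Iic]
    constructor
    · intro h; exact ⟨⟨h.1, h.2.trans hr.2⟩, h.2⟩
    · intro h; exact ⟨h.1.1, h.2⟩
  have h2 : ∫ s in 0..t, ∫ r in s..t, k r s =
      ∫ s, ∫ r, {p : ℝ × ℝ | p.2 ≤ p.1}.indicator (Function.uncurry k) (r, s) ∂μ ∂μ := by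
    rw [intervalIntegral.integral_of_le ht]
    exact setIntegral_congr_fun measurableSet_Ioc fun s hs =>
      integral_eq_integral_indicator_triangle hs k
  rw [h1, h2]
  exact integral_integral_swap (f := fun r s =>
    {p : ℝ × ℝ | p.2 ≤ p.1}.indicator (Function.uncurry k) (r, s)) (hk.indicator hm)

/-- Extending `k` by its end values makes it continuous on `ℝ`, so the end points need no separate
treatment. -/
theorem hasDerivWithinAt_primitive [CompleteSpace X] {T : ℝ} (hT : 0 ≤ T) {k v : ℝ → X}
    (hk : ContinuousOn k (Icc 0 T)) {c : X} (hv : ∀ t ∈ Icc 0 T, v t = c + ∫ s in 0..t, k s) {t : ℝ}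
    (ht : t ∈ Icc 0 T) : HasDerivWithinAt v (k t) (Icc 0 T) t := by
  set K : ℝ → X := IccExtend hT ((Icc 0 T).domRestrict k)
  have hK : Continuous K := (continuousOn_iff_continuous_domRestrict.1 hk).Icc_extend'
  have hKk : ∀ s ∈ Icc 0 T, K s = k s := fun s hs => by
    simp only [K, IccExtend_of_mem hT _ hs, domRestrict_apply]
  have hd : HasDerivAt (fun t => c + ∫ s in 0..t, K s) (K t) t :=
    (intervalIntegral.integral_hasDerivAt_right (hK.intervalIntegrable _ _)
      (hK.stronglyMeasurableAtFilter _ _) hK.continuousAt).const_add c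
  rw [hKk t ht] at hd
  have he : ∀ t ∈ Icc 0 T, v t = c + ∫ s in 0..t, K s := by
    intro t ht
    rw [hv t ht]
    congr 1
    refine intervalIntegral.integral_congr fun s hs => (hKk s ?_).symm
    rw [uIcc_of_le ht.1] at hs
    exact ⟨hs.1, hs.2.trans ht.2⟩
  exact hd.hasDerivWithinAt.congr he (he t ht)

end Interval

/-- A strongly continuous family of contractions `E t`, extended by `1` to negative times, together
with the resolvent `R = (1 + A)⁻¹` of minus its generator. The graph of `A` is the set of the pairs
`(x, y)` with `R (x + y) = x`. -/
structure ContractionFamily (X : Type*) [NormedAddCommGroup X] [InnerProductSpace ℝ X] where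
  E : ℝ → X →L[ℝ] X
  R : X →L[ℝ] X
  norm_le : ∀ t x, ‖E t x‖ ≤ ‖x‖
  continuous_time : ∀ x, Continuous fun t => E t x
  of_nonpos : ∀ t ≤ 0, ∀ x, E t x = x
  comm : ∀ t x, R (E t x) = E t (R x)
  resolvent_integral : ∀ t, 0 ≤ t → ∀ x,
    R ((∫ s in 0..t, E s x) + (x - E t x)) = ∫ s in 0..t, E s x
  accretive : ∀ x y, R (x + y) = x → 0 ≤ inner ℝ x y

namespace ContractionFamily

variable {X : Type*} [NormedAddCommGroup X] [InnerProductSpace ℝ X] (A : ContractionFamily X)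

/-- Strong continuity becomes joint continuity by uniform contractivity. This is what makes `s ↦ E
(φ s) (g s)` measurable for merely integrable `g`. -/
theorem continuous_apply : Continuous fun p : ℝ × X => A.E p.1 p.2 := by
  rw [continuous_iff_continuousAt]
  rintro ⟨t, x⟩
  rw [ContinuousAt, tendsto_iff_norm_sub_tendsto_zero]
  have h1 : Filter.Tendsto (fun p : ℝ × X => ‖p.2 - x‖ + ‖A.E p.1 x - A.E t x‖)
      (nhds (t, x)) (nhds 0) := by
    have : Continuous fun p : ℝ × X => ‖p.2 - x‖ + ‖A.E p.1 x - A.E t x‖ :=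
      ((continuous_snd.sub continuous_const).norm).add
        ((((A.continuous_time x).comp continuous_fst).sub continuous_const).norm)
    simpa using this.tendsto (t, x)
  refine squeeze_zero (fun _ => norm_nonneg _) (fun p => ?_) h1
  calc ‖A.E p.1 p.2 - A.E t x‖ = ‖A.E p.1 (p.2 - x) + (A.E p.1 x - A.E t x)‖ := by
        rw [map_sub]; congr 1; abel
    _ ≤ _ := (norm_add_le _ _).trans (add_le_add (A.norm_le _ _) le_rfl)

theorem intervalIntegrable_apply {g : ℝ → X} {a b : ℝ} (hg : IntervalIntegrable g volume a b)
    {φ : ℝ → ℝ} (hφ : Continuous φ) :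
    IntervalIntegrable (fun s => A.E (φ s) (g s)) volume a b := by
  refine hg.mono_fun ?_ (Filter.Eventually.of_forall fun s => A.norm_le _ _)
  exact A.continuous_apply.comp_aestronglyMeasurable
    (hφ.aestronglyMeasurable.prodMk hg.def'.aestronglyMeasurable)

theorem integrable_prod_apply {g : ℝ → X} {t : ℝ} (ht : 0 ≤ t)
    (hg : IntervalIntegrable g volume 0 t) {φ : ℝ × ℝ → ℝ} (hφ : Continuous φ) :
    Integrable (Function.uncurry fun r s => A.E (φ (r, s)) (g s))
      ((volume.restrict (Ioc 0 t)).prod (volume.restrict (Ioc 0 t))) := by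
  have hg' : Integrable g (volume.restrict (Ioc 0 t)) :=
    (intervalIntegrable_iff_integrableOn_Ioc_of_le ht).1 hg
  have h1 : Integrable (fun p : ℝ × ℝ => g p.2)
      ((volume.restrict (Ioc 0 t)).prod (volume.restrict (Ioc 0 t))) := hg'.comp_snd _
  refine h1.mono ?_ (Filter.Eventually.of_forall fun p => A.norm_le _ _)
  exact A.continuous_apply.comp_aestronglyMeasurable
    (hφ.aestronglyMeasurable.prodMk h1.aestronglyMeasurable)

/-- The mild solution of the inhomogeneous equation with zero initial value. -/
noncomputable def duhamel (g : ℝ → X) (t : ℝ) : X := ∫ s in 0..t, A.E (t - s) (g s)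

theorem integral_apply_sub (x : X) (s t : ℝ) :
    ∫ r in s..t, A.E (r - s) x = ∫ r in s..t, A.E (t - r) x := by
  rw [intervalIntegral.integral_comp_sub_right (fun r => A.E r x),
    intervalIntegral.integral_comp_sub_left (fun r => A.E r x), sub_self, sub_self]

theorem integral_apply_sub_eq (x : X) (s t : ℝ) :
    ∫ r in s..t, A.E (r - s) x = ∫ r in 0..(t - s), A.E r x := by
  rw [intervalIntegral.integral_comp_sub_right (fun r => A.E r x), sub_self]

/-- Uniqueness of classical solutions, by the energy method. -/
theorem eqOn_zero_of_deriv {w w' : ℝ → X} {T : ℝ} (hw0 : w 0 = 0)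
    (hw : ∀ t ∈ Icc 0 T, HasDerivWithinAt w (w' t) (Icc 0 T) t)
    (hR : ∀ t ∈ Icc 0 T, A.R (w t - w' t) = w t) : ∀ t ∈ Icc 0 T, w t = 0 := by
  intro t ht
  have hanti : AntitoneOn (fun t => ‖w t‖ ^ 2) (Icc 0 T) := by
    -- Since `w' = -A w`, the derivative of `‖w‖²` is `-2⟪w, A w⟫ ≤ 0`.
    refine antitoneOn_of_hasDerivWithinAt_nonpos (f' := fun t => 2 * inner ℝ (w t) (w' t))
      (convex_Icc 0 T) ?_ ?_ ?_
    · exact fun s hs => ((hw s hs).continuousWithinAt.norm).pow 2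
    · intro s hs
      exact ((hw s (interior_subset hs)).norm_sq).mono interior_subset
    · intro s hs
      have := A.accretive (w s) (-w' s) (by rw [← sub_eq_add_neg]; exact hR s (interior_subset hs))
      rw [inner_neg_right] at this
      linarith
  have := hanti ⟨le_rfl, ht.1.trans ht.2⟩ ht ht.1
  simp only [hw0, norm_zero] at this
  have h2 : ‖w t‖ ^ 2 ≤ 0 := by simpa using this
  have h3 : ‖w t‖ ^ 2 = 0 := le_antisymm h2 (sq_nonneg _)
  simpa using h3

/-- As `E` is the identity at negative times, `∫₀ᵀ E (t-s) (g s) ds` exceeds the mild term by `∫ₜᵀ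
g`. The integral over the fixed interval is continuous in `t` by dominated convergence. -/
theorem continuousOn_duhamel {g : ℝ → X} {T : ℝ} (hT : 0 ≤ T)
    (hg : IntervalIntegrable g volume 0 T) : ContinuousOn (A.duhamel g) (Icc 0 T) := by
  have h1 : Continuous fun t => ∫ s in 0..T, A.E (t - s) (g s) := by
    refine intervalIntegral.continuous_of_dominated_interval (bound := fun s => ‖g s‖)
      (fun t => (A.intervalIntegrable_apply hg (by fun_prop)).def'.aestronglyMeasurable)
      (fun t => Filter.Eventually.of_forall fun s _ => A.norm_le _ _) hg.norm
      (Filter.Eventually.of_forall fun s _ => ?_)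
    exact (A.continuous_time (g s)).comp (by fun_prop)
  have h2 : ContinuousOn (fun t => ∫ s in 0..t, g s) (Icc 0 T) := by
    have := intervalIntegral.continuousOn_primitive_interval (μ := volume) (f := g) (a := 0) (b := T)
      (by rw [uIcc_of_le hT, integrableOn_Icc_iff_integrableOn_Ioc]
          exact (intervalIntegrable_iff_integrableOn_Ioc_of_le hT).1 hg)
    rwa [uIcc_of_le hT] at this
  refine ((h1.continuousOn.sub (continuousOn_const (c := ∫ s in 0..T, g s))).add h2).congr
    fun t ht => ?_
  have i1 : IntervalIntegrable g volume 0 t := hg.mono_set (by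
    rw [uIcc_of_le ht.1, uIcc_of_le hT]; exact Icc_subset_Icc_right ht.2)
  have i2 : IntervalIntegrable g volume t T := hg.mono_set (by
    rw [uIcc_of_le ht.2, uIcc_of_le hT]; exact Icc_subset_Icc_left ht.1)
  simp only [duhamel, Pi.add_apply, Pi.sub_apply]
  rw [← intervalIntegral.integral_add_adjacent_intervals
      (A.intervalIntegrable_apply i1 (φ := fun s => t - s) (by fun_prop))
      (A.intervalIntegrable_apply i2 (φ := fun s => t - s) (by fun_prop)),
    ← intervalIntegral.integral_add_adjacent_intervals i1 i2]
  have : ∫ s in t..T, A.E (t - s) (g s) = ∫ s in t..T, g s := by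
    refine intervalIntegral.integral_congr fun s hs => A.of_nonpos _ ?_ _
    rw [uIcc_of_le ht.2] at hs
    linarith [hs.1]
  rw [this]
  abel

variable [CompleteSpace X]

/-- Apply `resolvent_integral` to `x + y`: since `R` returns `x`, the integrals of `E s x` cancel.
This is `x - E_t x = ∫ E_s A x ds` without differentiating anything. -/
theorem sub_apply_eq_integral {x y : X} (h : A.R (x + y) = x) {t : ℝ} (ht : 0 ≤ t) :
    x - A.E t x = ∫ s in 0..t, A.E s y := by
  have hi : ∀ z, IntervalIntegrable (fun s => A.E s z) volume 0 t := fun z =>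
    (A.continuous_time z).intervalIntegrable _ _
  have h1 := A.resolvent_integral t ht (x + y)
  have h2 : A.R (∫ s in 0..t, A.E s (x + y)) = ∫ s in 0..t, A.E s x := by
    rw [← ContinuousLinearMap.intervalIntegral_comp_comm _ (hi _)]
    simp only [A.comm, h]
  have h3 : ∫ s in 0..t, A.E s (x + y) = (∫ s in 0..t, A.E s x) + ∫ s in 0..t, A.E s y := by
    simp only [map_add]
    exact intervalIntegral.integral_add (hi x) (hi y)
  rw [map_add, h2, map_sub, h, A.comm, h, h3] at h1
  exact add_left_cancel h1

/-- The inhomogeneous part of the solution when the right-hand side takes values in the domain. -/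
theorem duhamel_of_mem_domain {f g : ℝ → X} {t : ℝ} (ht : 0 ≤ t)
    (hf : IntervalIntegrable f volume 0 t) (hg : IntervalIntegrable g volume 0 t)
    (h : ∀ᵐ s ∂volume.restrict (Ioc 0 t), A.R (f s + g s) = f s) :
    A.duhamel f t = (∫ s in 0..t, (f s - A.duhamel g s)) ∧
      A.R (A.duhamel f t + A.duhamel g t) = A.duhamel f t := by
  have hEf := A.intervalIntegrable_apply hf (φ := fun s => t - s) (by fun_prop)
  have hEg := A.intervalIntegrable_apply hg (φ := fun s => t - s) (by fun_prop)
  constructor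
  · have h1 : ∫ s in 0..t, A.duhamel g s = ∫ s in 0..t, (f s - A.E (t - s) (f s)) := by
      simp only [duhamel]
      rw [integral_triangle_swap ht (A.integrable_prod_apply ht hg
        (φ := fun p => p.1 - p.2) (by fun_prop))]
      rw [intervalIntegral.integral_of_le ht, intervalIntegral.integral_of_le ht]
      refine integral_congr_ae ?_
      filter_upwards [h, ae_restrict_mem measurableSet_Ioc] with s hs hst
      rw [A.integral_apply_sub_eq, A.sub_apply_eq_integral hs (by linarith [hst.2])]
    have hc := (A.continuousOn_duhamel ht hg).intervalIntegrable_of_Icc (μ := volume) ht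
    rw [intervalIntegral.integral_sub hf hc, h1, intervalIntegral.integral_sub hf hEf]
    simp [duhamel]
  -- Closedness of `A`: the bounded operator `R` passes under the integral and the relation holds
  -- for almost every `s`.
  · simp only [duhamel]
    rw [← intervalIntegral.integral_add hEf hEg,
      ← ContinuousLinearMap.intervalIntegral_comp_comm _ (hEf.add hEg),
      intervalIntegral.integral_of_le ht, intervalIntegral.integral_of_le ht]
    refine integral_congr_ae ?_
    filter_upwards [h] with s hs
    rw [← map_add, A.comm, hs]

/-- The inhomogeneous part of the solution when the right-hand side is absolutely continuous. -/
theorem duhamel_of_primitive {f g : ℝ → X} {t : ℝ} (ht : 0 ≤ t) {c : X}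
    (hg : IntervalIntegrable g volume 0 t)
    (h : ∀ s ∈ Icc 0 t, f s = c + ∫ r in 0..s, g r) :
    A.duhamel f t = (∫ s in 0..t, (A.E s c + A.duhamel g s)) ∧
      A.R (A.duhamel f t + (f t - (A.E t c + A.duhamel g t))) = A.duhamel f t := by
  have hi : IntervalIntegrable (fun s => A.E s c) volume 0 t :=
    (A.continuous_time c).intervalIntegrable _ _
  have hEg := A.intervalIntegrable_apply hg (φ := fun s => t - s) (by fun_prop)
  have hprim : ContinuousOn (fun s => ∫ r in 0..s, g r) (Icc 0 t) := by
    have := intervalIntegral.continuousOn_primitive_interval (μ := volume) (f := g) (a := 0) (b := t)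
      (by rw [uIcc_of_le ht, integrableOn_Icc_iff_integrableOn_Ioc]
          exact (intervalIntegrable_iff_integrableOn_Ioc_of_le ht).1 hg)
    rwa [uIcc_of_le ht] at this
  have hsub : ∀ s ∈ Icc 0 t, IntervalIntegrable g volume 0 s := fun s hs => hg.mono_set (by
    rw [uIcc_of_le ht, uIcc_of_le hs.1]; exact Icc_subset_Icc_right hs.2)
  have hK := A.integrable_prod_apply ht hg (φ := fun p => t - p.1) (by fun_prop)
  -- Inserting `f = c + ∫ g` and swapping leaves only integrals `∫ E_s x ds`, which lie in the
  -- domain even though `c` and `g` need not.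
  have e1 : A.duhamel f t = (∫ s in 0..t, A.E s c) +
      ∫ r in 0..t, ∫ s in 0..(t - r), A.E s (g r) := by
    have e : A.duhamel f t = ∫ s in 0..t, (A.E (t - s) c + ∫ r in 0..s, A.E (t - s) (g r)) := by
      refine intervalIntegral.integral_congr fun s hs => ?_
      rw [uIcc_of_le ht] at hs
      rw [h s hs, map_add, ContinuousLinearMap.intervalIntegral_comp_comm _ (hsub s hs)]
    rw [e, intervalIntegral.integral_add, intervalIntegral.integral_comp_sub_left
      (fun s => A.E s c), sub_self, sub_zero, integral_triangle_swap ht hK]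
    · congr 1
      refine intervalIntegral.integral_congr fun s _ => ?_
      rw [← A.integral_apply_sub, A.integral_apply_sub_eq]
    · exact ((A.continuous_time c).comp (by fun_prop)).intervalIntegrable _ _
    · have := A.intervalIntegrable_apply
        (hprim.intervalIntegrable_of_Icc (μ := volume) ht) (φ := fun s => t - s) (by fun_prop)
      refine this.congr fun s hs => ?_
      rw [uIoc_of_le ht] at hs
      rw [ContinuousLinearMap.intervalIntegral_comp_comm _ (hsub s ⟨hs.1.le, hs.2⟩)]
  have hJ : IntervalIntegrable (fun r => ∫ s in 0..(t - r), A.E s (g r)) volume 0 t := by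
    refine (intervalIntegrable_triangle ht hK).congr fun s _ => ?_
    simp only
    rw [← A.integral_apply_sub, A.integral_apply_sub_eq]
  constructor
  · rw [intervalIntegral.integral_add hi
      ((A.continuousOn_duhamel ht hg).intervalIntegrable_of_Icc (μ := volume) ht), e1]
    congr 1
    simp only [duhamel]
    rw [integral_triangle_swap ht (A.integrable_prod_apply ht hg
        (φ := fun p => p.1 - p.2) (by fun_prop))]
    simp only [A.integral_apply_sub_eq]
  -- The candidate for `A (duhamel f)` is split into `c - E_t c` and `g(s) - E_{t-s} g(s)`, matching
  -- `e1` term by term for `resolvent_integral`.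
  · have e2 : f t - (A.E t c + A.duhamel g t) =
        (c - A.E t c) + ∫ s in 0..t, (g s - A.E (t - s) (g s)) := by
      rw [h t ⟨ht, le_rfl⟩, intervalIntegral.integral_sub hg hEg, duhamel]
      abel
    rw [e2, e1, add_add_add_comm, map_add, A.resolvent_integral t ht c,
      ← intervalIntegral.integral_add hJ (hg.sub hEg),
      ← ContinuousLinearMap.intervalIntegral_comp_comm _ (hJ.add (hg.sub hEg))]
    congr 1
    refine intervalIntegral.integral_congr fun s hs => ?_
    rw [uIcc_of_le ht] at hs
    exact A.resolvent_integral _ (by linarith [hs.2]) _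

theorem hasDerivWithinAt_apply {x y : X} (h : A.R (x + y) = x) {T t : ℝ} (hT : 0 ≤ T)
    (ht : t ∈ Icc 0 T) : HasDerivWithinAt (fun t => A.E t x) (-A.E t y) (Icc 0 T) t := by
  refine hasDerivWithinAt_primitive hT (c := x) (k := fun t => -A.E t y)
    (A.continuous_time y).neg.continuousOn (fun s hs => ?_) ht
  rw [intervalIntegral.integral_neg, ← A.sub_apply_eq_integral h hs.1]
  abel

/-- Duhamel's principle: the mild solution is a classical solution. -/
theorem exists_deriv_mild_solution {f : ℝ → X} {T : ℝ} (hT : 0 ≤ T) (hf : ContinuousOn f (Icc 0 T))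
    {x y : X} (hxy : A.R (x + y) = x)
    (h : (∃ g : ℝ → X, IntervalIntegrable g volume 0 T ∧
        ∀ᵐ s ∂volume.restrict (Ioc 0 T), A.R (f s + g s) = f s) ∨
      (∃ g : ℝ → X, IntervalIntegrable g volume 0 T ∧
        ∃ c, ∀ s ∈ Icc 0 T, f s = c + ∫ r in 0..s, g r)) :
    ∃ u' : ℝ → X, ContinuousOn u' (Icc 0 T) ∧ ∀ t ∈ Icc 0 T,
      HasDerivWithinAt (fun t => A.E t x + A.duhamel f t) (u' t) (Icc 0 T) t ∧
      A.R ((A.E t x + A.duhamel f t) + (f t - u' t)) = A.E t x + A.duhamel f t := by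
  have hsub : ∀ {g : ℝ → X}, IntervalIntegrable g volume 0 T → ∀ t ∈ Icc 0 T,
      IntervalIntegrable g volume 0 t := fun hg t ht => hg.mono_set (by
    rw [uIcc_of_le hT, uIcc_of_le ht.1]; exact Icc_subset_Icc_right ht.2)
  have hfi := hf.intervalIntegrable_of_Icc (μ := volume) hT
  -- `w` is the derivative of the mild term: `f - duhamel (A f)` in the first case, `E c + duhamel
  -- f'` in the second.
  obtain ⟨w, hw, key⟩ : ∃ w : ℝ → X, ContinuousOn w (Icc 0 T) ∧ ∀ t ∈ Icc 0 T,
      A.duhamel f t = (∫ s in 0..t, w s) ∧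
      A.R (A.duhamel f t + (f t - w t)) = A.duhamel f t := by
    rcases h with ⟨g, hg, h⟩ | ⟨g, hg, c, h⟩
    · refine ⟨fun t => f t - A.duhamel g t, hf.sub (A.continuousOn_duhamel hT hg), fun t ht => ?_⟩
      rw [sub_sub_cancel]
      exact A.duhamel_of_mem_domain ht.1 (hsub hfi t ht) (hsub hg t ht)
        (ae_restrict_of_ae_restrict_of_subset (Ioc_subset_Ioc_right ht.2) h)
    · refine ⟨fun t => A.E t c + A.duhamel g t,
        (A.continuous_time c).continuousOn.add (A.continuousOn_duhamel hT hg), fun t ht => ?_⟩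
      exact A.duhamel_of_primitive ht.1 (hsub hg t ht)
        fun s hs => h s ⟨hs.1, hs.2.trans ht.2⟩
  refine ⟨fun t => -A.E t y + w t, (A.continuous_time y).neg.continuousOn.add hw, fun t ht =>
    ⟨(A.hasDerivWithinAt_apply hxy hT ht).add (hasDerivWithinAt_primitive hT hw (c := 0)
      (fun s hs => by rw [zero_add]; exact (key s hs).1) ht), ?_⟩⟩
  rw [show A.E t x + A.duhamel f t + (f t - (-A.E t y + w t)) =
    A.E t (x + y) + (A.duhamel f t + (f t - w t)) by rw [map_add]; abel, map_add, A.comm, hxy,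
    (key t ht).2]

end ContractionFamily

/-! ### Weakly differentiable functions on an interval -/

section DuBoisReymond

variable {X : Type*} [NormedAddCommGroup X] [NormedSpace ℝ X] [CompleteSpace X]

theorem exists_Icc_of_isCompact_subset_Ioo {K : Set ℝ} {a b : ℝ} (hab : a < b) (hK : IsCompact K)
    (h : K ⊆ Ioo a b) : ∃ c d, a < c ∧ d < b ∧ K ⊆ Icc c d := by
  rcases K.eq_empty_or_nonempty with rfl | hne
  -- The reversed bounds give an empty closed interval.
  · exact ⟨b, a, hab, hab, empty_subset _⟩
  · exact ⟨sInf K, sSup K, (h (hK.sInf_mem hne)).1, (h (hK.sSup_mem hne)).2,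
      fun x hx => ⟨csInf_le hK.bddBelow hx, le_csSup hK.bddAbove hx⟩⟩

/-- A test function of integral zero is the derivative of a test function. -/
theorem exists_primitive_of_integral_eq_zero {T : ℝ} (hT : 0 < T) {η : ℝ → ℝ} (hη : ContDiff ℝ ∞ η)
    (hc : HasCompactSupport η) (hs : tsupport η ⊆ Ioo 0 T) (h0 : ∫ x, η x = 0) :
    ∃ φ : ℝ → ℝ, ContDiff ℝ ∞ φ ∧ HasCompactSupport φ ∧ tsupport φ ⊆ Ioo 0 T ∧ deriv φ = η := by
  obtain ⟨a, b, ha, hb, hab⟩ := exists_Icc_of_isCompact_subset_Ioo hT hc.isCompact hs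
  have hd : ∀ t, HasDerivAt (fun t => ∫ s in 0..t, η s) (η t) t := fun t =>
    hη.continuous.integral_hasStrictDerivAt 0 t |>.hasDerivAt
  have hderiv : deriv (fun t => ∫ s in 0..t, η s) = η := funext fun t => (hd t).deriv
  have hz : ∀ s ∉ Icc a b, η s = 0 := fun s h =>
    image_eq_zero_of_notMem_tsupport fun h' => h (hab h')
  have hsub : Function.support (fun t => ∫ s in 0..t, η s) ⊆ Icc a b := by
    intro t ht
    by_contra hn
    apply ht
    rw [mem_Icc, not_and_or, not_le, not_le] at hn
    rcases hn with hn | hn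
    · refine (intervalIntegral.integral_congr (g := fun _ => (0 : ℝ)) fun s hs => hz s ?_).trans
        (by simp)
      intro h
      have := (mem_uIcc.1 hs)
      rcases this with h1 | h1 <;> linarith [h.1]
    · change ∫ s in 0..t, η s = 0
      by_cases ht0 : 0 ≤ t
      · rw [intervalIntegral.integral_of_le ht0]
        refine (setIntegral_eq_integral_of_forall_compl_eq_zero fun s hs => hz s fun h =>
          hs ?_).trans h0
        exact ⟨ha.trans_le h.1, h.2.trans hn.le⟩
      · refine (intervalIntegral.integral_congr (g := fun _ => (0 : ℝ)) fun s hs => hz s ?_).trans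
          (by simp)
        intro h
        have := (mem_uIcc.1 hs)
        rcases this with h1 | h1 <;> linarith [h.1]
  have hts : tsupport (fun t => ∫ s in 0..t, η s) ⊆ Icc a b := closure_minimal hsub isClosed_Icc
  refine ⟨fun t => ∫ s in 0..t, η s, ?_, ?_, ?_, hderiv⟩
  · rw [contDiff_infty_iff_deriv, hderiv]
    exact ⟨fun t => (hd t).differentiableAt, hη⟩
  · exact HasCompactSupport.of_support_subset_isCompact isCompact_Icc hsub
  · exact hts.trans (Icc_subset_Ioo ha hb)

/-- The du Bois-Reymond lemma. -/
theorem eqOn_const_of_integral_deriv_smul_eq_zero {T : ℝ} (hT : 0 < T) {F : ℝ → X}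
    (hF : ContinuousOn F (Icc 0 T))
    (h : ∀ φ : ℝ → ℝ, ContDiff ℝ ∞ φ → HasCompactSupport φ → tsupport φ ⊆ Ioo 0 T →
      ∫ t in Ioo 0 T, deriv φ t • F t = 0) : ∃ c, ∀ t ∈ Icc 0 T, F t = c := by
  obtain ⟨ρ, hρs, hρc, hρ, hρr, hρ1⟩ := exists_contDiff_tsupport_subset (n := ⊤)
    (Ioo_mem_nhds (half_pos hT) (half_lt_self hT))
  have hρi : Integrable ρ := hρ.continuous.integrable_of_hasCompactSupport hρc
  have hI : 0 < ∫ x, ρ x :=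
    hρ.continuous.integral_pos_of_hasCompactSupport_nonneg_nonzero hρc
      (fun x => (hρr ⟨x, rfl⟩).1) (x := T / 2) (by rw [hρ1]; exact one_ne_zero)
  set I := ∫ x, ρ x
  have hFi : ∀ ψ : ℝ → ℝ, Continuous ψ → IntegrableOn (fun t => ψ t • F t) (Ioo 0 T) := by
    intro ψ hψ
    exact ((hψ.continuousOn.smul hF).integrableOn_Icc).mono_set Ioo_subset_Icc_self
  -- The constant can only be the mean of `F` weighted by the normalised bump `ρ`.
  set c : X := I⁻¹ • ∫ t in Ioo 0 T, ρ t • F t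
  refine ⟨c, ?_⟩
  have hae : ∀ᵐ t : ℝ, t ∈ Ioo 0 T → F t - c = 0 := by
    refine isOpen_Ioo.ae_eq_zero_of_integral_contDiff_smul_eq_zero ?_ fun ψ hψ hψc hψs => ?_
    · exact ((hF.sub continuousOn_const).mono Ioo_subset_Icc_self).locallyIntegrableOn
        measurableSet_Ioo
    · have hψi : Integrable ψ := hψ.continuous.integrable_of_hasCompactSupport hψc
      set J := ∫ x, ψ x
      -- Subtracting the multiple of `ρ` with the same integral as `ψ` leaves a test function of
      -- integral zero, hence a derivative to which `h` applies.
      set η : ℝ → ℝ := fun t => ψ t - (J * I⁻¹) * ρ t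
      have hηd : ContDiff ℝ ∞ η := hψ.sub (contDiff_const.mul hρ)
      have hsupp : Function.support η ⊆ tsupport ψ ∪ tsupport ρ := by
        intro t ht
        by_contra hn
        rw [mem_union, not_or] at hn
        apply ht
        simp [η, image_eq_zero_of_notMem_tsupport hn.1, image_eq_zero_of_notMem_tsupport hn.2]
      have hηc : HasCompactSupport η :=
        HasCompactSupport.of_support_subset_isCompact (hψc.isCompact.union hρc.isCompact) hsupp
      have hηs : tsupport η ⊆ Ioo 0 T :=
        (closure_minimal hsupp ((isClosed_tsupport _).union (isClosed_tsupport _))).trans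
          (union_subset hψs hρs)
      have hη0 : ∫ x, η x = 0 := by
        simp only [η]
        rw [integral_sub hψi (hρi.const_mul _), integral_const_mul]
        change J - J * I⁻¹ * I = 0
        field_simp
        ring
      obtain ⟨φ, h1, h2, h3, h4⟩ := exists_primitive_of_integral_eq_zero hT hηd hηc hηs hη0
      have h5 := h φ h1 h2 h3
      simp only [h4, η, sub_smul, mul_smul] at h5
      have hρF : IntegrableOn (fun t => J • I⁻¹ • ρ t • F t) (Ioo 0 T) :=
        ((hFi ρ hρ.continuous).smul I⁻¹).smul J
      rw [integral_sub (hFi ψ hψ.continuous) hρF,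
        integral_smul, integral_smul] at h5
      have hJ : ∫ t in Ioo 0 T, ψ t = J :=
        setIntegral_eq_integral_of_forall_compl_eq_zero fun s hs =>
          image_eq_zero_of_notMem_tsupport fun h => hs (hψs h)
      have h6 : ∫ t, ψ t • (F t - c) = ∫ t in Ioo 0 T, ψ t • (F t - c) :=
        (setIntegral_eq_integral_of_forall_compl_eq_zero fun s hs => by
          rw [image_eq_zero_of_notMem_tsupport fun h => hs (hψs h), zero_smul]).symm
      rw [h6]
      simp only [smul_sub]
      rw [integral_sub (hFi ψ hψ.continuous) (hψi.integrableOn.smul_const c), integral_smul_const,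
        hJ]
      exact h5
  have hae' : F =ᵐ[volume.restrict (Icc 0 T)] fun _ => c := by
    rw [← Measure.restrict_congr_set Ioo_ae_eq_Icc]
    filter_upwards [ae_restrict_of_ae hae, ae_restrict_mem measurableSet_Ioo] with t h1 h2
    exact sub_eq_zero.1 (h1 h2)
  exact Measure.eqOn_Icc_of_ae_eq volume hT.ne hae' hF continuousOn_const

/-- A continuous function of class `W^{1,1}` is a primitive of its weak derivative. -/
theorem MemW11.exists_primitive {T : ℝ} (hT : 0 < T) {f : ℝ → X} (hf : ContinuousOn f (Icc 0 T))
    (h : MemW11 T f) : ∃ g : ℝ → X, IntervalIntegrable g volume 0 T ∧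
      ∃ c, ∀ s ∈ Icc 0 T, f s = c + ∫ r in 0..s, g r := by
  obtain ⟨-, g, hg, h⟩ := h
  have hg' : IntervalIntegrable g volume 0 T :=
    (intervalIntegrable_iff_integrableOn_Ioo_of_le hT.le).2 hg
  refine ⟨g, hg', ?_⟩
  have hprim : ContinuousOn (fun s => ∫ r in 0..s, g r) (Icc 0 T) := by
    have := intervalIntegral.continuousOn_primitive_interval (μ := volume) (f := g) (a := 0) (b := T)
      (by rw [uIcc_of_le hT.le, integrableOn_Icc_iff_integrableOn_Ioo]; exact hg)
    rwa [uIcc_of_le hT.le] at this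
  have hconst : ∃ c, ∀ t ∈ Icc 0 T, f t - ∫ r in 0..t, g r = c := by
    refine eqOn_const_of_integral_deriv_smul_eq_zero hT (hf.sub hprim) fun φ hφ hφc hφs => ?_
    have hφ' : Continuous (deriv φ) := hφ.continuous_deriv (by norm_num)
    have hT0 : φ T = 0 := image_eq_zero_of_notMem_tsupport fun h => (hφs h).2.false
    -- Integration by parts for a primitive of an integrable function is Fubini on the triangle
    -- together with `∫ₛᵀ φ' = -φ(s)`.
    have h1 : ∫ t in Ioo 0 T, deriv φ t • ∫ r in 0..t, g r = -∫ t in Ioo 0 T, φ t • g t := by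
      rw [← integral_Ioc_eq_integral_Ioo, ← integral_Ioc_eq_integral_Ioo,
        ← intervalIntegral.integral_of_le hT.le, ← intervalIntegral.integral_of_le hT.le,
        ← intervalIntegral.integral_neg]
      simp only [← intervalIntegral.integral_smul]
      rw [integral_triangle_swap hT.le (k := fun t r => deriv φ t • g r)]
      · refine intervalIntegral.integral_congr fun s _ => ?_
        rw [intervalIntegral.integral_smul_const, intervalIntegral.integral_deriv_eq_sub'
          φ rfl (fun x _ => (hφ.differentiable (by norm_num)) x) hφ'.continuousOn, hT0, zero_sub,
          neg_smul]
      · exact Integrable.smul_prod ((hφ'.continuousOn.integrableOn_Icc).mono_set Ioc_subset_Icc_self)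
          ((intervalIntegrable_iff_integrableOn_Ioc_of_le hT.le).1 hg')
    simp only [smul_sub]
    rw [integral_sub, h1, h φ hφ hφc hφs, sub_self]
    · exact ((hφ'.continuousOn.smul hf).integrableOn_Icc).mono_set Ioo_subset_Icc_self
    · exact ((hφ'.continuousOn.smul hprim).integrableOn_Icc).mono_set Ioo_subset_Icc_self
  obtain ⟨c, hc⟩ := hconst
  exact ⟨c, fun s hs => by rw [← hc s hs]; abel⟩

end DuBoisReymond

/-! ### Pointwise evaluation of `L²`-valued integrals -/

section Evaluation

variable {Ω Θ : Type*} [MeasurableSpace Ω] [MeasurableSpace Θ] {μ : Measure Ω} [SigmaFinite μ]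
  {ν : Measure Θ}

/-- On a set of finite measure the `L¹` norm is at most a constant times the `L²` norm, so the
double integral of `‖K‖` is controlled by `∫ ‖F‖`. -/
theorem integrable_prod_restrict_of_L2 {F : Θ → Lp ℂ 2 μ} (hF : Integrable F ν) {K : Θ → Ω → ℂ}
    (hK : AEStronglyMeasurable (Function.uncurry K) (ν.prod μ)) (hFK : ∀ᵐ τ ∂ν, F τ =ᵐ[μ] K τ)
    {A : Set Ω} (hA : μ A ≠ ⊤) :
    Integrable (Function.uncurry K) (ν.prod (μ.restrict A)) := by
  have hK' : AEStronglyMeasurable (Function.uncurry K) (ν.prod (μ.restrict A)) :=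
    hK.mono_ac (Measure.AbsolutelyContinuous.rfl.prod Measure.restrict_le_self.absolutelyContinuous)
  have hfin : IsFiniteMeasure (μ.restrict A) := ⟨by simpa using hA.lt_top⟩
  have hFA : ∀ τ, MemLp (F τ) 2 (μ.restrict A) := fun τ => (Lp.memLp (F τ)).restrict A
  rw [integrable_prod_iff hK']
  constructor
  · filter_upwards [hFK] with τ h
    exact ((hFA τ).integrable (by norm_num)).congr (ae_restrict_of_ae h)
  · set C : ENNReal := (μ.restrict A) univ ^ (1 / (1 : ENNReal).toReal - 1 / (2 : ENNReal).toReal)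
    have hC : C ≠ ⊤ := ENNReal.rpow_ne_top_of_nonneg (by norm_num) (measure_ne_top _ _)
    refine (hF.norm.mul_const C.toReal).mono' hK'.norm.integral_prod_right' ?_
    filter_upwards [hFK] with τ h
    rw [Real.norm_of_nonneg (integral_nonneg fun _ => norm_nonneg _)]
    have e : ∫ y, ‖Function.uncurry K (τ, y)‖ ∂μ.restrict A = ∫ y, ‖F τ y‖ ∂μ.restrict A :=
      integral_congr_ae (by filter_upwards [ae_restrict_of_ae h] with y hy; rw [hy]; rfl)
    rw [e, integral_norm_eq_lintegral_enorm (hFA τ).1, ← eLpNorm_one_eq_lintegral_enorm,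
      Lp.norm_def, ← ENNReal.toReal_mul]
    refine ENNReal.toReal_mono (ENNReal.mul_ne_top (Lp.eLpNorm_ne_top _) hC) ?_
    exact (eLpNorm_le_eLpNorm_mul_rpow_measure_univ (by norm_num) (hFA τ).1).trans
      (mul_le_mul_left (eLpNorm_mono_measure _ Measure.restrict_le_self) _)

variable [SFinite ν]

/-- If a jointly measurable function `K` represents `F : Θ → L²`, then the Bochner integral of `F`
is computed pointwise almost everywhere. -/
theorem integral_L2_ae_eq {F : Θ → Lp ℂ 2 μ} (hF : Integrable F ν) {K : Θ → Ω → ℂ}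
    (hK : AEStronglyMeasurable (Function.uncurry K) (ν.prod μ)) (hFK : ∀ᵐ τ ∂ν, F τ =ᵐ[μ] K τ) :
    ∀ᵐ x ∂μ, Integrable (fun τ => K τ x) ν ∧ (∫ τ, F τ ∂ν : Lp ℂ 2 μ) x = ∫ τ, K τ x ∂ν := by
  have hint : ∀ᵐ x ∂μ, Integrable (fun τ => K τ x) ν := by
    rw [← Measure.restrict_univ (μ := μ), ← iUnion_spanningSets μ, ae_restrict_iUnion_iff]
    exact fun n => (integrable_prod_restrict_of_L2 hF hK hFK
      (measure_spanningSets_lt_top μ n).ne).prod_left_ae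
  have heq : (∫ τ, F τ ∂ν : Lp ℂ 2 μ) =ᵐ[μ] fun x => ∫ τ, K τ x ∂ν := by
    refine ae_eq_of_forall_setIntegral_eq_of_sigmaFinite (fun B _ hμB => ?_) (fun B _ hμB => ?_)
      fun B hB hμB => ?_
    · have : IsFiniteMeasure (μ.restrict B) := ⟨by simpa using hμB⟩
      exact ((Lp.memLp _).restrict B).integrable (by norm_num)
    · exact (integrable_prod_restrict_of_L2 hF hK hFK hμB.ne).integral_prod_right
    · have hKB := integrable_prod_restrict_of_L2 hF hK hFK hμB.ne
      -- Integration over `B` is a continuous functional on `L²`, so it commutes with the Bochner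
      -- integral; Fubini does the same on the side of `K`.
      rw [← L2.inner_indicatorConstLp_one hB hμB.ne]
      have h1 := ContinuousLinearMap.integral_comp_comm
        (innerSL ℂ (indicatorConstLp 2 hB hμB.ne (1 : ℂ))) hF
      simp only [innerSL_apply_apply] at h1
      rw [← h1, ← integral_integral_swap hKB]
      refine integral_congr_ae ?_
      filter_upwards [hFK] with τ h
      rw [L2.inner_indicatorConstLp_one]
      exact integral_congr_ae (ae_restrict_of_ae h)
  filter_upwards [hint, heq] with x h1 h2 using ⟨h1, h2⟩

end Evaluation

/-! ### Multiplication operators on `L²` -/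

section Multiplication

variable {Ω : Type*} [MeasurableSpace Ω] {μ : Measure Ω}

theorem L2_norm_sq_eq (f : Lp ℂ 2 μ) : ‖f‖ ^ 2 = ∫ x, ‖f x‖ ^ 2 ∂μ := by
  rw [← real_inner_self_eq_norm_sq, L2.inner_def]
  simp only [real_inner_self_eq_norm_sq]

/-- Dominated convergence in `L²`, for families with continuous parameter. -/
theorem continuousAt_L2_of_dominated {Y : Type*} [TopologicalSpace Y] [FirstCountableTopology Y]
    {G : Y → Lp ℂ 2 μ} {g : Y → Ω → ℂ} (hGg : ∀ y, G y =ᵐ[μ] g y) {b : Ω → ℝ} (hb : MemLp b 2 μ)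
    {y₀ : Y} (hbound : ∀ᶠ y in nhds y₀, ∀ x, ‖g y x‖ ≤ b x)
    (hcont : ∀ x, ContinuousAt (fun y => g y x) y₀) : ContinuousAt G y₀ := by
  have h1 : Filter.Tendsto (fun y => ∫ x, ‖g y x - g y₀ x‖ ^ 2 ∂μ) (nhds y₀) (nhds 0) := by
    have := tendsto_integral_filter_of_dominated_convergence (μ := μ)
      (F := fun y x => ‖g y x - g y₀ x‖ ^ 2) (f := fun _ => (0 : ℝ)) (l := nhds y₀)
      (fun x => 4 * b x ^ 2) ?_ ?_ (hb.integrable_sq.const_mul 4) ?_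
    · simpa using this
    · refine Filter.Eventually.of_forall fun y => ?_
      exact ((((Lp.aestronglyMeasurable (G y)).congr (hGg y)).sub
        ((Lp.aestronglyMeasurable (G y₀)).congr (hGg y₀))).norm).pow 2
    · filter_upwards [hbound] with y hy
      refine Filter.Eventually.of_forall fun x => ?_
      rw [Real.norm_of_nonneg (by positivity)]
      have h2 := hy x
      have h3 := hbound.self_of_nhds x
      have h4 : ‖g y x - g y₀ x‖ ≤ 2 * b x := (norm_sub_le _ _).trans (by linarith)
      nlinarith [norm_nonneg (g y x - g y₀ x)]
    · refine Filter.Eventually.of_forall fun x => ?_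
      have : ContinuousAt (fun y => ‖g y x - g y₀ x‖ ^ 2) y₀ :=
        (((hcont x).sub continuousAt_const).norm).pow 2
      simpa [ContinuousAt] using this
  rw [ContinuousAt, tendsto_iff_norm_sub_tendsto_zero]
  have h2 : ∀ y, ‖G y - G y₀‖ = Real.sqrt (∫ x, ‖g y x - g y₀ x‖ ^ 2 ∂μ) := by
    intro y
    rw [← Real.sqrt_sq (norm_nonneg (G y - G y₀)), L2_norm_sq_eq]
    congr 1
    refine integral_congr_ae ?_
    filter_upwards [Lp.coeFn_sub (G y) (G y₀), hGg y, hGg y₀] with x e1 e2 e3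
    rw [e1, Pi.sub_apply, e2, e3]
  simp only [h2]
  simpa [Function.comp_def] using (Real.continuous_sqrt.tendsto 0).comp h1

/-- A measurable real function bounded by one. -/
structure IsContractiveMultiplier (m : Ω → ℝ) : Prop where
  measurable : Measurable m
  norm_le_one : ∀ x, |m x| ≤ 1

theorem IsContractiveMultiplier.memLp {m : Ω → ℝ} (hm : IsContractiveMultiplier m)
    (F : Lp ℂ 2 μ) : MemLp (fun x => (m x : ℂ) * F x) 2 μ := by
  refine (Lp.memLp F).of_le ((Complex.measurable_ofReal.comp hm.measurable).aestronglyMeasurable.mul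
    (Lp.aestronglyMeasurable F)) (Filter.Eventually.of_forall fun x => ?_)
  rw [norm_mul, Complex.norm_real, Real.norm_eq_abs]
  exact mul_le_of_le_one_left (norm_nonneg _) (hm.norm_le_one x)

theorem IsContractiveMultiplier.norm_toLp_le {m : Ω → ℝ} (hm : IsContractiveMultiplier m)
    (F : Lp ℂ 2 μ) : ‖(hm.memLp F).toLp _‖ ≤ ‖F‖ := by
  refine Lp.norm_le_norm_of_ae_le ?_
  filter_upwards [(hm.memLp F).coeFn_toLp] with x hx
  rw [hx, norm_mul, Complex.norm_real, Real.norm_eq_abs]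
  exact mul_le_of_le_one_left (norm_nonneg _) (hm.norm_le_one x)

/-- The operator of multiplication by `m` on `L²`. -/
noncomputable def IsContractiveMultiplier.mulL2 (μ : Measure Ω) {m : Ω → ℝ}
    (hm : IsContractiveMultiplier m) : Lp ℂ 2 μ →L[ℝ] Lp ℂ 2 μ :=
  LinearMap.mkContinuous
    { toFun := fun F => (hm.memLp F).toLp _
      map_add' := fun F G => by
        rw [← MemLp.toLp_add]
        refine MemLp.toLp_congr _ _ ?_
        filter_upwards [Lp.coeFn_add F G] with x hx
        simp only [hx, Pi.add_apply, mul_add]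
      map_smul' := fun c F => by
        rw [RingHom.id_apply, ← MemLp.toLp_const_smul]
        refine MemLp.toLp_congr _ _ ?_
        filter_upwards [Lp.coeFn_smul c F] with x hx
        simp only [hx, Pi.smul_apply, Complex.real_smul]
        ring } 1 fun F => by rw [one_mul]; exact hm.norm_toLp_le F

theorem IsContractiveMultiplier.coeFn_mulL2 {m : Ω → ℝ} (hm : IsContractiveMultiplier m)
    (F : Lp ℂ 2 μ) : hm.mulL2 μ F =ᵐ[μ] fun x => (m x : ℂ) * F x :=
  (hm.memLp F).coeFn_toLp

/-- The truncation `max t 0` makes the multiplier `1` for negative times, as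
`ContractionFamily.of_nonpos` demands. -/
theorem isContractiveMultiplier_exp {w : Ω → ℝ} (hw : Measurable w) (hw0 : ∀ x, 0 ≤ w x) (t : ℝ) :
    IsContractiveMultiplier fun x => Real.exp (-max t 0 * w x) where
  measurable := Real.measurable_exp.comp (hw.const_mul _)
  norm_le_one x := by
    rw [abs_of_pos (Real.exp_pos _), Real.exp_le_one_iff]
    have := mul_nonneg (le_max_right t 0) (hw0 x)
    linarith

theorem isContractiveMultiplier_resolvent {w : Ω → ℝ} (hw : Measurable w) (hw0 : ∀ x, 0 ≤ w x) :
    IsContractiveMultiplier fun x => (1 + w x)⁻¹ where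
  measurable := (hw.const_add 1).inv
  norm_le_one x := by
    have := hw0 x
    rw [abs_of_pos (by positivity)]
    exact inv_le_one_of_one_le₀ (by linarith)

theorem mul_integral_exp_neg_mul (w t : ℝ) :
    w * ∫ s in 0..t, Real.exp (-s * w) = 1 - Real.exp (-t * w) := by
  rw [← intervalIntegral.integral_const_mul]
  have h : ∀ s ∈ uIcc 0 t, HasDerivAt (fun s => -Real.exp (-s * w)) (w * Real.exp (-s * w)) s := by
    intro s _
    have := (((hasDerivAt_id s).neg.mul_const w).exp).neg
    refine this.congr_deriv ?_
    rw [Pi.neg_apply, id]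
    ring
  rw [intervalIntegral.integral_eq_sub_of_hasDerivAt h
    (Continuous.intervalIntegrable (by fun_prop) _ _)]
  simp only [neg_zero, zero_mul, Real.exp_zero]
  ring

/-- Links the resolvent encoding to the unbounded multiplication operator; pointwise it only clears
the denominator `1 + w`. -/
theorem resolvent_mulL2_eq_iff {w : Ω → ℝ} (hw : Measurable w) (hw0 : ∀ x, 0 ≤ w x)
    {F H : Lp ℂ 2 μ} :
    (isContractiveMultiplier_resolvent hw hw0).mulL2 μ (F + H) = F ↔
      H =ᵐ[μ] fun x => (w x : ℂ) * F x := by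
  have h0 : ∀ x, (1 + (w x : ℂ)) ≠ 0 := fun x => by
    have : (1 + w x) ≠ 0 := by have := hw0 x; positivity
    exact_mod_cast this
  have h1 := (isContractiveMultiplier_resolvent hw hw0).coeFn_mulL2 (F + H)
  rw [Lp.ext_iff]
  constructor <;> intro h
  · filter_upwards [h, h1, Lp.coeFn_add F H] with x e1 e2 e3
    rw [e1, e3, Pi.add_apply] at e2
    push_cast at e2
    have := h0 x
    field_simp at e2
    linear_combination -e2
  · filter_upwards [h, h1, Lp.coeFn_add F H] with x e1 e2 e3
    rw [e2, e3, Pi.add_apply, e1]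
    have := h0 x
    push_cast
    field_simp

variable [SigmaFinite μ]

theorem coeFn_integral_mulL2_exp {w : Ω → ℝ} (hw : Measurable w) (hw0 : ∀ x, 0 ≤ w x)
    (F : Lp ℂ 2 μ) (hc : Continuous fun t => (isContractiveMultiplier_exp hw hw0 t).mulL2 μ F)
    {t : ℝ} (ht : 0 ≤ t) :
    (∫ s in 0..t, (isContractiveMultiplier_exp hw hw0 s).mulL2 μ F : Lp ℂ 2 μ) =ᵐ[μ]
      fun x => ((∫ s in 0..t, Real.exp (-s * w x) : ℝ) : ℂ) * F x := by
  rw [intervalIntegral.integral_of_le ht]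
  have hint : Integrable (fun s => (isContractiveMultiplier_exp hw hw0 s).mulL2 μ F)
      (volume.restrict (Ioc 0 t)) :=
    (hc.continuousOn.integrableOn_Icc).mono_set Ioc_subset_Icc_self
  have key := integral_L2_ae_eq hint (K := fun s x => (Real.exp (-max s 0 * w x) : ℂ) * F x) ?_
    (Filter.Eventually.of_forall fun s => (isContractiveMultiplier_exp hw hw0 s).coeFn_mulL2 F)
  · filter_upwards [key] with x hx
    rw [hx.2, integral_mul_const, intervalIntegral.integral_of_le ht, ← integral_complex_ofReal]
    congr 1
    refine setIntegral_congr_fun measurableSet_Ioc fun s hs => ?_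
    simp only [max_eq_left hs.1.le]
  · refine AEStronglyMeasurable.mul ?_ (Lp.aestronglyMeasurable F).comp_snd
    refine (Complex.measurable_ofReal.comp (Real.measurable_exp.comp ?_)).aestronglyMeasurable
    exact ((measurable_fst.max measurable_const).neg).mul (hw.comp measurable_snd)

/-- The contraction family `e^{-tw}` of multiplication operators. -/
noncomputable def mulContractionFamily (μ : Measure Ω) [SigmaFinite μ] {w : Ω → ℝ}
    (hw : Measurable w) (hw0 : ∀ x, 0 ≤ w x) : ContractionFamily (Lp ℂ 2 μ) :=
  have hc : ∀ F : Lp ℂ 2 μ,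
      Continuous fun t => (isContractiveMultiplier_exp hw hw0 t).mulL2 μ F := by
    intro F
    rw [continuous_iff_continuousAt]
    intro t
    refine continuousAt_L2_of_dominated
      (fun t => (isContractiveMultiplier_exp hw hw0 t).coeFn_mulL2 F)
      (Lp.memLp F).norm (Filter.Eventually.of_forall fun s x => ?_) fun x => ?_
    · rw [norm_mul, Complex.norm_real, Real.norm_eq_abs]
      exact mul_le_of_le_one_left (norm_nonneg _)
        ((isContractiveMultiplier_exp hw hw0 s).norm_le_one x)
    · exact Continuous.continuousAt (by fun_prop)
  { E := fun t => (isContractiveMultiplier_exp hw hw0 t).mulL2 μ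
    R := (isContractiveMultiplier_resolvent hw hw0).mulL2 μ
    norm_le := fun t F => (isContractiveMultiplier_exp hw hw0 t).norm_toLp_le F
    continuous_time := hc
    of_nonpos := fun t ht F => by
      rw [Lp.ext_iff]
      filter_upwards [(isContractiveMultiplier_exp hw hw0 t).coeFn_mulL2 F] with x hx
      rw [hx, max_eq_right ht]
      simp
    comm := fun t F => by
      rw [Lp.ext_iff]
      filter_upwards [(isContractiveMultiplier_exp hw hw0 t).coeFn_mulL2 F,
        (isContractiveMultiplier_resolvent hw hw0).coeFn_mulL2 F,
        (isContractiveMultiplier_exp hw hw0 t).coeFn_mulL2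
          ((isContractiveMultiplier_resolvent hw hw0).mulL2 μ F),
        (isContractiveMultiplier_resolvent hw hw0).coeFn_mulL2
          ((isContractiveMultiplier_exp hw hw0 t).mulL2 μ F)] with x h1 h2 h3 h4
      rw [h4, h3, h1, h2]
      ring
    resolvent_integral := fun t ht F => by
      rw [resolvent_mulL2_eq_iff hw hw0]
      filter_upwards [coeFn_integral_mulL2_exp hw hw0 F (hc F) ht,
        Lp.coeFn_sub F ((isContractiveMultiplier_exp hw hw0 t).mulL2 μ F),
        (isContractiveMultiplier_exp hw hw0 t).coeFn_mulL2 F] with x h1 h2 h3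
      rw [h2, h1, Pi.sub_apply, h3, ← mul_assoc, ← Complex.ofReal_mul,
        mul_integral_exp_neg_mul, max_eq_left ht]
      push_cast
      ring
    accretive := fun F H h => by
      rw [resolvent_mulL2_eq_iff hw hw0] at h
      rw [L2.inner_def]
      refine integral_nonneg_of_ae ?_
      filter_upwards [h] with x hx
      rw [hx, ← Complex.real_smul, inner_smul_right, Pi.zero_apply]
      exact mul_nonneg (hw0 x) real_inner_self_nonneg }

end Multiplication

/-- Transport of a contraction family by a linear isometry equivalence. -/
noncomputable def ContractionFamily.conj {X Y : Type*} [NormedAddCommGroup X]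
    [InnerProductSpace ℝ X] [CompleteSpace X] [NormedAddCommGroup Y] [InnerProductSpace ℝ Y]
    [CompleteSpace Y] (A : ContractionFamily Y) (U : X ≃ₗᵢ[ℝ] Y) : ContractionFamily X where
  E t := (U.symm.toContinuousLinearEquiv : Y →L[ℝ] X) ∘L A.E t ∘L
    (U.toContinuousLinearEquiv : X →L[ℝ] Y)
  R := (U.symm.toContinuousLinearEquiv : Y →L[ℝ] X) ∘L A.R ∘L
    (U.toContinuousLinearEquiv : X →L[ℝ] Y)
  norm_le t x := by
    have := A.norm_le t (U x)
    rw [U.norm_map] at this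
    exact (U.symm.norm_map _).trans_le this
  continuous_time x := U.symm.continuous.comp (A.continuous_time (U x))
  of_nonpos t ht x := (congrArg U.symm (A.of_nonpos t ht (U x))).trans (U.symm_apply_apply x)
  comm t x := by
    change U.symm (A.R (U (U.symm (A.E t (U x))))) = U.symm (A.E t (U (U.symm (A.R (U x)))))
    rw [U.apply_symm_apply, U.apply_symm_apply, A.comm]
  resolvent_integral t ht x := by
    have h : ∫ s in 0..t, U.symm (A.E s (U x)) = U.symm (∫ s in 0..t, A.E s (U x)) :=
      ContinuousLinearMap.intervalIntegral_comp_comm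
        (U.symm.toContinuousLinearEquiv : Y →L[ℝ] X)
        ((A.continuous_time (U x)).intervalIntegrable _ _)
    change U.symm (A.R (U ((∫ s in 0..t, U.symm (A.E s (U x))) + (x - U.symm (A.E t (U x)))))) =
      ∫ s in 0..t, U.symm (A.E s (U x))
    rw [h, map_add, map_sub, U.apply_symm_apply, U.apply_symm_apply, A.resolvent_integral t ht]
  accretive x y h := by
    have h' : A.R (U x + U y) = U x := by
      rw [← map_add]
      exact (U.apply_symm_apply _).symm.trans (congrArg U h)
    rw [← U.inner_map_map]
    exact A.accretive _ _ h'

variable {α : ℝ}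

/-! ### The heat semigroup -/

theorem measurable_normS_rpow (α : ℝ) : Measurable fun ξ : QS S => normS S ξ ^ α :=
  measurable_normS.pow_const α

theorem normS_rpow_nonneg (α : ℝ) (ξ : QS S) : 0 ≤ normS S ξ ^ α :=
  Real.rpow_nonneg (normS_nonneg ξ) α

/-- The Fourier transform, as a real linear isometry. -/
noncomputable def realFourierL2 (S : Finset Nat.Primes) : L2 S ≃ₗᵢ[ℝ] L2 S where
  toLinearEquiv := (fourierL2 S).toLinearEquiv.restrictScalars ℝ
  norm_map' := (fourierL2 S).norm_map

/-- The semigroup generated by `-D^α`, with its resolvent. -/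
noncomputable def heatFamily (S : Finset Nat.Primes) (α : ℝ) : ContractionFamily (L2 S) :=
  (mulContractionFamily (haarQS S) (measurable_normS_rpow α) (normS_rpow_nonneg α)).conj
    (realFourierL2 S)

/-- The bridge between the abstract Cauchy problem and `D^α`. -/
theorem heatFamily_R_eq_iff {f h : L2 S} :
    (heatFamily S α).R (f + h) = f ↔ (f, h) ∈ graphD S α := by
  have h1 : (heatFamily S α).R (f + h) = f ↔
      fourierL2 S h =ᵐ[haarQS S] fun ξ => ((normS S ξ ^ α : ℝ) : ℂ) * fourierL2 S f ξ := by
    rw [← resolvent_mulL2_eq_iff (measurable_normS_rpow α) (normS_rpow_nonneg α), ← map_add]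
    exact (fourierL2 S).toEquiv.symm_apply_eq
  rw [h1]
  constructor
  · exact fun h => ⟨_, _, isFourier_iff.2 rfl, isFourier_iff.2 rfl, h⟩
  · rintro ⟨F, H, hF, hH, h⟩
    rw [isFourier_iff] at hF hH
    subst hF hH
    exact h

theorem mem_domD_iff {f : L2 S} : f ∈ domD S α ↔ ∃ h, (f, h) ∈ graphD S α := by
  constructor
  · rintro ⟨F, hF, hm⟩
    refine ⟨(fourierL2 S).symm (hm.toLp _), F, hm.toLp _, hF, ?_, hm.coeFn_toLp⟩
    exact isFourier_iff.2 ((fourierL2 S).apply_symm_apply _)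
  · rintro ⟨h, F, H, hF, hH, e⟩
    exact ⟨F, hF, (Lp.memLp H).ae_eq e⟩

/-- The squared modulus is the exponential at time `2s`, already known to be integrable. -/
theorem memLp_chi_mul_exp (hα : 0 < α) (x : QS S) {s : ℝ} (hs : 0 < s) :
    MemLp (fun ξ => chi S (x * ξ) * (Real.exp (-s * normS S ξ ^ α) : ℂ)) 2 (haarQS S) := by
  have hmeas : AEStronglyMeasurable
      (fun ξ => chi S (x * ξ) * (Real.exp (-s * normS S ξ ^ α) : ℂ)) (haarQS S) :=
    (continuous_chi.comp (by fun_prop)).aestronglyMeasurable.mul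
      (Complex.measurable_ofReal.comp (Real.measurable_exp.comp
        ((measurable_normS_rpow α).const_mul (-s)))).aestronglyMeasurable
  rw [memLp_two_iff_integrable_sq_norm hmeas]
  refine (integrable_exp_neg_normS hα (mul_pos two_pos hs)).congr
    (Filter.Eventually.of_forall fun ξ => ?_)
  simp only
  rw [norm_mul, norm_chi, one_mul, Complex.norm_real, Real.norm_of_nonneg (Real.exp_pos _).le,
    ← Real.exp_nat_mul]
  congr 1
  push_cast
  ring

/-- The function `ξ ↦ χ(xξ) exp(-s‖ξ‖^α)` as an element of `L²`. -/
noncomputable def heatSymbol (hα : 0 < α) (y : QS S × Ioi (0 : ℝ)) : L2 S :=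
  (memLp_chi_mul_exp hα y.1 y.2.2).toLp _

theorem coeFn_heatSymbol (hα : 0 < α) (y : QS S × Ioi (0 : ℝ)) :
    heatSymbol hα y =ᵐ[haarQS S]
      fun ξ => chi S (y.1 * ξ) * (Real.exp (-y.2 * normS S ξ ^ α) : ℂ) :=
  (memLp_chi_mul_exp hα y.1 y.2.2).coeFn_toLp

/-- Near time `s` all symbols are dominated by the one at time `s/2`. The joint continuity later
yields joint measurability of the convolutions in `(τ, x)`. -/
theorem continuous_heatSymbol (hα : 0 < α) : Continuous (heatSymbol (S := S) hα) := by
  rw [continuous_iff_continuousAt]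
  rintro ⟨x, s, hs⟩
  have hs' : 0 < s / 2 := half_pos hs
  have hb : MemLp (fun ξ => Real.exp (-(s / 2) * normS S ξ ^ α)) 2 (haarQS S) := by
    refine (memLp_chi_mul_exp hα 0 hs').norm.ae_eq (Filter.Eventually.of_forall fun ξ => ?_)
    simp only
    rw [norm_mul, norm_chi, one_mul, Complex.norm_real, Real.norm_of_nonneg (Real.exp_pos _).le]
  refine continuousAt_L2_of_dominated (coeFn_heatSymbol hα) hb ?_ fun ξ => ?_
  · have hc : Continuous fun y : QS S × Ioi (0 : ℝ) => (y.2 : ℝ) := by fun_prop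
    filter_upwards [hc.continuousAt.eventually_const_lt
      (show s / 2 < (s : ℝ) from half_lt_self hs)] with y hy ξ
    rw [norm_mul, norm_chi, one_mul, Complex.norm_real, Real.norm_of_nonneg (Real.exp_pos _).le]
    refine Real.exp_le_exp.2 (mul_le_mul_of_nonneg_right ?_ (normS_rpow_nonneg α ξ))
    linarith
  · refine Continuous.continuousAt ((continuous_chi.comp (by fun_prop)).mul ?_)
    fun_prop

theorem conj_heatKernel (x : QS S) (t : ℝ) :
    starRingEnd ℂ (heatKernel S α x t) = heatKernel S α (-x) t := by
  rw [heatKernel, heatKernel, ← integral_conj]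
  simp only [map_mul, conj_chi, Complex.conj_ofReal, neg_mul, neg_neg]

theorem fourierL2_symm_heatSymbol (hα : 0 < α) (x : QS S) {s : ℝ} (hs : 0 < s) :
    (fourierL2 S).symm (heatSymbol hα (x, ⟨s, hs⟩)) =ᵐ[haarQS S]
      fun y => heatKernel S α (y - x) s := by
  have hint : Integrable (heatSymbol hα (x, ⟨s, hs⟩)) (haarQS S) := by
    have h : Integrable (fun ξ => (Real.exp (-s * normS S ξ ^ α) : ℂ)) (haarQS S) :=
      (integrable_exp_neg_normS hα hs).ofReal
    refine (integrable_chi_mul h (-x)).congr ?_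
    filter_upwards [coeFn_heatSymbol hα (x, ⟨s, hs⟩)] with ξ hξ
    rw [hξ, neg_mul, neg_neg]
  filter_upwards [fourierL2_symm_ae_eq hint] with y hy
  rw [hy, invFourierInt, heatKernel]
  refine integral_congr_ae ?_
  filter_upwards [coeFn_heatSymbol hα (x, ⟨s, hs⟩)] with ξ hξ
  rw [hξ, ← mul_assoc, ← chi_add]
  congr 2
  ring

theorem heatKernel_mul_ae_eq (hα : 0 < α) (x : QS S) {s : ℝ} (hs : 0 < s) (u : L2 S) :
    (fun y => inner ℂ ((fourierL2 S).symm (heatSymbol hα (x, ⟨s, hs⟩)) y) (u y)) =ᵐ[haarQS S]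
      fun y => heatKernel S α (x - y) s * u y := by
  filter_upwards [fourierL2_symm_heatSymbol hα x hs] with y hy
  rw [hy, RCLike.inner_apply, conj_heatKernel, neg_sub, mul_comm]

theorem integrable_heatKernel_mul (hα : 0 < α) (x : QS S) {s : ℝ} (hs : 0 < s) (u : L2 S) :
    Integrable (fun y => heatKernel S α (x - y) s * u y) (haarQS S) :=
  (L2.integrable_inner _ u).congr (heatKernel_mul_ae_eq hα x hs u)

/-- By unitarity, convolution with `Z` at the single point `x` is an `L²` pairing, which is
meaningful for every `x`. -/
theorem integral_heatKernel_mul (hα : 0 < α) (x : QS S) {s : ℝ} (hs : 0 < s) (u : L2 S) :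
    ∫ y, heatKernel S α (x - y) s * u y ∂haarQS S =
      inner ℂ (heatSymbol hα (x, ⟨s, hs⟩)) (fourierL2 S u) := by
  rw [← integral_congr_ae (heatKernel_mul_ae_eq hα x hs u), ← L2.inner_def,
    ← (fourierL2 S).inner_map_map, LinearIsometryEquiv.apply_symm_apply]

/-- The heat semigroup acts by convolution with the heat kernel. -/
theorem heatFamily_E_ae_eq (hα : 0 < α) {s : ℝ} (hs : 0 < s) (u : L2 S) :
    (heatFamily S α).E s u =ᵐ[haarQS S]
      fun x => ∫ y, heatKernel S α (x - y) s * u y ∂haarQS S := by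
  set G : L2 S := (isContractiveMultiplier_exp (measurable_normS_rpow α)
    (normS_rpow_nonneg α) s).mulL2 (haarQS S) (fourierL2 S u) with hG
  have hGe : G =ᵐ[haarQS S] fun ξ => (Real.exp (-s * normS S ξ ^ α) : ℂ) * fourierL2 S u ξ := by
    filter_upwards [(isContractiveMultiplier_exp (measurable_normS_rpow α)
      (normS_rpow_nonneg α) s).coeFn_mulL2 (fourierL2 S u)] with ξ hξ
    rw [hG, hξ, max_eq_left hs.le]
  have hinner : ∀ x, (fun ξ => inner ℂ (heatSymbol hα (x, ⟨s, hs⟩) ξ) (fourierL2 S u ξ))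
      =ᵐ[haarQS S] fun ξ => chi S (-(x * ξ)) * G ξ := by
    intro x
    filter_upwards [hGe, coeFn_heatSymbol hα (x, ⟨s, hs⟩)] with ξ h1 h2
    rw [h1, h2, RCLike.inner_apply, map_mul, conj_chi, Complex.conj_ofReal]
    ring
  -- `G` is a product of two `L²` functions, so it is integrable and its inverse transform is an
  -- actual integral.
  have hint : Integrable G (haarQS S) := by
    refine ((L2.integrable_inner (𝕜 := ℂ) _ _).congr (hinner 0)).congr
      (Filter.Eventually.of_forall fun ξ => ?_)
    simp
  have hE : (heatFamily S α).E s u = (fourierL2 S).symm G := rfl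
  rw [hE]
  filter_upwards [fourierL2_symm_ae_eq hint] with x hx
  rw [hx, integral_heatKernel_mul hα x hs, invFourierInt, L2.inner_def]
  exact (integral_congr_ae (hinner x)).symm

theorem MemL1Dom.exists_intervalIntegrable {T : ℝ} (hT : 0 < T) {f : ℝ → L2 S}
    (h : MemL1Dom S α T f) : ∃ g : ℝ → L2 S, IntervalIntegrable g volume 0 T ∧
      ∀ᵐ s ∂volume.restrict (Ioc 0 T), (heatFamily S α).R (f s + g s) = f s := by
  obtain ⟨g, hg, hgf⟩ := h
  refine ⟨fun t => (g t : L2 S × L2 S).2, ?_, ?_⟩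
  · rw [intervalIntegrable_iff_integrableOn_Ioo_of_le hT.le]
    exact ((ContinuousLinearMap.snd ℂ (L2 S) (L2 S)).comp (graphD S α).subtypeL).integrable_comp hg
  · rw [← Measure.restrict_congr_set Ioo_ae_eq_Ioc]
    filter_upwards [hgf] with t ht
    rw [heatFamily_R_eq_iff, ← ht]
    exact (g t).2

/-- The time integral in Duhamel's formula can be computed pointwise. -/
theorem duhamel_ae_eq (hα : 0 < α) {f : ℝ → L2 S} {t : ℝ} (ht : 0 < t)
    (hf : ContinuousOn f (Icc 0 t)) : ∀ᵐ x ∂haarQS S,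
      IntegrableOn (fun τ => ∫ y, heatKernel S α (x - y) (t - τ) * f τ y ∂haarQS S) (Ioo 0 t) ∧
      (heatFamily S α).duhamel f t x =
        ∫ τ in Ioo 0 t, (∫ y, heatKernel S α (x - y) (t - τ) * f τ y ∂haarQS S) := by
  have hi : Integrable (fun τ => (heatFamily S α).E (t - τ) (f τ)) (volume.restrict (Ioo 0 t)) :=
    (intervalIntegrable_iff_integrableOn_Ioo_of_le ht.le).1
      ((heatFamily S α).intervalIntegrable_apply (hf.intervalIntegrable_of_Icc (μ := volume) ht.le)
        (φ := fun τ => t - τ) (by fun_prop))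
  -- On `τ < t` the convolution is the inner product of two `L²` elements continuous in `(τ, x)`.
  -- Continuity may fail at `τ = t`, hence the open interval.
  have hK : AEStronglyMeasurable (Function.uncurry fun τ x =>
      ∫ y, heatKernel S α (x - y) (t - τ) * f τ y ∂haarQS S)
      ((volume.restrict (Ioo 0 t)).prod (haarQS S)) := by
    have e : (volume.restrict (Ioo 0 t)).prod (haarQS S) =
        ((volume : Measure ℝ).prod (haarQS S)).restrict (Ioo 0 t ×ˢ univ) := by
      rw [← Measure.prod_restrict, Measure.restrict_univ]
    rw [e]
    refine ContinuousOn.aestronglyMeasurable ?_ (measurableSet_Ioo.prod MeasurableSet.univ)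
    rw [continuousOn_iff_continuous_domRestrict]
    have hf' : Continuous fun z : (Ioo 0 t ×ˢ univ : Set (ℝ × QS S)) => f z.1.1 :=
      hf.comp_continuous (by fun_prop) fun z => Ioo_subset_Icc_self z.2.1
    have hsym : Continuous fun z : (Ioo 0 t ×ˢ univ : Set (ℝ × QS S)) =>
        heatSymbol hα (z.1.2, ⟨t - z.1.1, sub_pos.2 z.2.1.2⟩) :=
      (continuous_heatSymbol hα).comp (by fun_prop)
    refine (hsym.inner ((fourierL2 S).continuous.comp hf')).congr fun z => ?_
    exact (integral_heatKernel_mul hα _ _ _).symm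
  have key := integral_L2_ae_eq hi hK (by
    filter_upwards [ae_restrict_mem measurableSet_Ioo] with τ hτ
    exact heatFamily_E_ae_eq hα (sub_pos.2 hτ.2) (f τ))
  rw [← integral_Ioc_eq_integral_Ioo, ← intervalIntegral.integral_of_le ht.le] at key
  exact key

end SAdic

/-! ### Assembly of Duhamel's principle for `D^α` -/

theorem theorem6p2 (S : Finset Nat.Primes) (α T : ℝ) (hα : 0 < α) (hT : 0 < T)
    (f : ℝ → SAdic.L2 S) (hf : ContinuousOn f (Icc 0 T))
    (hf' : SAdic.MemL1Dom S α T f ∨ SAdic.MemW11 T f)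
    (u₀ : SAdic.L2 S) (hu₀ : u₀ ∈ SAdic.domD S α) :
    ∃ u : ℝ → SAdic.L2 S,
      SAdic.IsClassicalSolution S α T f u₀ u ∧
      (∀ v : ℝ → SAdic.L2 S, SAdic.IsClassicalSolution S α T f u₀ v → EqOn v u (Icc 0 T)) ∧
      -- the integrals over `y` in the representation formula converge absolutely for every `x`
      (∀ t ∈ Ioc 0 T, ∀ x : SAdic.QS S,
        Integrable (fun y => SAdic.heatKernel S α (x - y) t * u₀ y) (SAdic.haarQS S) ∧
        ∀ τ ∈ Ico 0 t,
          Integrable (fun y => SAdic.heatKernel S α (x - y) (t - τ) * f τ y) (SAdic.haarQS S)) ∧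
      -- the representation formula
      (∀ t ∈ Ioc 0 T, ∀ᵐ x ∂SAdic.haarQS S,
        IntegrableOn
          (fun τ => ∫ y, SAdic.heatKernel S α (x - y) (t - τ) * f τ y ∂SAdic.haarQS S)
          (Ioo 0 t) ∧
        u t x = (∫ y, SAdic.heatKernel S α (x - y) t * u₀ y ∂SAdic.haarQS S) +
          ∫ τ in Ioo 0 t,
            (∫ y, SAdic.heatKernel S α (x - y) (t - τ) * f τ y ∂SAdic.haarQS S)) := by
  set A := SAdic.heatFamily S α
  obtain ⟨y₀, hy₀⟩ := SAdic.mem_domD_iff.1 hu₀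
  have hR := SAdic.heatFamily_R_eq_iff.2 hy₀
  obtain ⟨u', hu', hu⟩ := A.exists_deriv_mild_solution hT.le hf hR
    (hf'.imp (·.exists_intervalIntegrable hT) (·.exists_primitive hT hf))
  refine ⟨fun t => A.E t u₀ + A.duhamel f t, ⟨?_, u', hu', fun t ht => ?_⟩, ?_, ?_, ?_⟩
  · simp [A.of_nonpos 0 le_rfl, SAdic.ContractionFamily.duhamel]
  · have := SAdic.heatFamily_R_eq_iff.1 (hu t ht).2
    exact ⟨(hu t ht).1, SAdic.mem_domD_iff.2 ⟨_, this⟩, this⟩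
  · rintro v ⟨hv0, v', -, hv⟩ t ht
    -- The source `f` cancels in the difference of two solutions, leaving the homogeneous equation
    -- with zero initial value.
    have h0 := A.eqOn_zero_of_deriv (w := fun t => v t - (A.E t u₀ + A.duhamel f t))
      (w' := fun t => v' t - u' t) (T := T) ?_ (fun s hs => (hv s hs).1.sub (hu s hs).1)
      (fun s hs => ?_) t ht
    · exact sub_eq_zero.1 h0
    · simp [A.of_nonpos 0 le_rfl, SAdic.ContractionFamily.duhamel, hv0]
    · have h1 := SAdic.heatFamily_R_eq_iff.2 (hv s hs).2.2
      have h2 := (hu s hs).2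
      have e : v s - (A.E s u₀ + A.duhamel f s) - (v' s - u' s) =
          (v s + (f s - v' s)) - ((A.E s u₀ + A.duhamel f s) + (f s - u' s)) := by abel
      rw [e, map_sub, h2, h1]
  · exact fun t ht x => ⟨SAdic.integrable_heatKernel_mul hα x ht.1 u₀,
      fun τ hτ => SAdic.integrable_heatKernel_mul hα x (sub_pos.2 hτ.2) (f τ)⟩
  · intro t ht
    filter_upwards [SAdic.duhamel_ae_eq hα ht.1 (hf.mono (Icc_subset_Icc_right ht.2)),
      SAdic.heatFamily_E_ae_eq hα ht.1 u₀, Lp.coeFn_add (A.E t u₀) (A.duhamel f t)] with x h1 h2 h3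
    refine ⟨h1.1, ?_⟩
    rw [h3, Pi.add_apply, h2, h1.2]
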